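/- Let $\mathcal A$ be a complex involutive Banach algebra (not necessarily unital) with isometric involution, and let $(\sigma_t)_{t\in\mathbb R}$ be a strongly continuous one-parameter group of isometric $*$-automorphisms of $\mathcal A$. Let $\mathcal O\subset\mathcal A$ be the involutive subalgebra of all $a$ for which $t\mapsto\sigma_t(a)$ extends to an entire function $z\mapsto\sigma_z(a)$ with values in $\mathcal A$, and let $\sigma$ be the automorphism of $\mathcal O$ given by (1PG) $\quad\sigma(a)=\sigma_{-i}(a)$, the value at $t=-i$ of the analytic extension of $t\mapsto\sigma_t(a)$. Let $\mathcal A$ act by a $*$-representation in a Hilbert space $\mathfrak H$, and let $(\mathcal O,\mathfrak H,D)$, with the restricted action, be a graded $\sigma$-spectral triple: $D$ is a self-adjoint operator with compact resolvent; for every $a\in\mathcal O$ the operator $a$ preserves the domain of $D$, and $d_\sigma a=D\,a-\sigma(a)\,D$ is bounded there; and $\gamma=\gamma^*$ is a bounded operator with $\gamma^2=1$ which commutes with the action of $\mathcal O$, preserves the domain of $D$ and satisfies $D\gamma=-\gamma D$. Suppose that $D$ has a bounded inverse $D^{-1}\in\mathcal L^{n,\infty}$ for some even integer $n\ge 2$,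 i.e. the characteristic values satisfy $\mu_k(D^{-1})=O(k^{-1/n})$. Write $\mathfrak H=\mathfrak H_+\oplus\mathfrak H_-$ for the decomposition into the eigenspaces of $\gamma$, $D_\pm:\mathfrak H_\pm\to\mathfrak H_\mp$ for the entries of $D$, and $a_\pm$ for those of $a$. Then for all $a^0,\dots,a^n\in\mathcal O$ the products of operators below are of trace class, the forms $$\Phi^{\pm}_{D,\sigma}(a^0,\dots,a^n)=\mathrm{Tr}\big(D_\pm^{-1}(D_\pm a^0_\pm-\sigma(a^0)_\mp D_\pm)\cdots D_\pm^{-1}(D_\pm a^n_\pm-\sigma(a^n)_\mp D_\pm)\big),$$ $$(\Phi^{+}_{D,\sigma})^*(a^0,\dots,a^n)=\overline{\Phi^+_{D,\sigma}((a^n)^*,\dots,(a^0)^*)}$$ are cyclic cocycles in $Z^n_\lambda(\mathcal O)$, and their classes in the even periodic cyclic cohomology $HP^{\mathrm{ev}}(\mathcal O)$ satisfy $$[\Phi^-_{D,\sigma}]=-\,[(\Phi^+_{D,\sigma})^*].$$ -/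

import Mathlib

open scoped ComplexConjugate InnerProductSpace DirectSum

noncomputable section

/-! ### Periodic cyclic cohomology of a (not necessarily unital) complex algebra -/

/-- The `(n+1)`-linear forms on `B`. -/
abbrev Cochain (B : Type*) [NonUnitalRing B] [Module ℂ B] (n : ℕ) : Type _ :=
  MultilinearMap ℂ (fun _ : Fin (n + 1) => B) ℂ

section Cyclic

variable (B : Type*) [NonUnitalRing B] [Module ℂ B]

section Faces

variable [IsScalarTower ℂ B B] [SMulCommClass ℂ B B]

/-- Multiplying two neighbouring entries is linear in each entry. -/
theorem contractNth_update (n : ℕ) (i : Fin (n + 1)) (v : Fin (n + 2) → B) (k : Fin (n + 2)) :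
    ∃ (p : Fin (n + 1)) (L : B →ₗ[ℂ] B), ∀ x : B,
      Fin.contractNth i.castSucc (· * ·) (Function.update v k x) =
        Function.update (Fin.contractNth i.castSucc (· * ·) v) p (L x) := by
  rcases lt_trichotomy (k : ℕ) i with hk | hk | hk
  · refine ⟨⟨k, by omega⟩, LinearMap.id, fun x => funext fun j => ?_⟩
    simp only [Fin.contractNth, Function.update_apply, Fin.ext_iff, Fin.val_castSucc, Fin.val_succ,
      LinearMap.id_apply]
    split_ifs <;> first | rfl | omega
  · refine ⟨i, LinearMap.mulRight ℂ (v i.succ), fun x => funext fun j => ?_⟩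
    simp only [Fin.contractNth, Function.update_apply, Fin.ext_iff, Fin.val_castSucc, Fin.val_succ,
      LinearMap.mulRight_apply]
    split_ifs with h1 h2 h3 h4 h5 h6 h7 <;> first | rfl | omega | skip
    all_goals
      obtain rfl : j = i := Fin.ext (by omega)
      rfl
  · by_cases hk' : (k : ℕ) = i + 1
    · refine ⟨i, LinearMap.mulLeft ℂ (v i.castSucc), fun x => funext fun j => ?_⟩
      simp only [Fin.contractNth, Function.update_apply, Fin.ext_iff, Fin.val_castSucc,
        Fin.val_succ, LinearMap.mulLeft_apply]
      split_ifs with h1 h2 h3 h4 h5 h6 h7 <;> first | rfl | omega | skip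
      all_goals
        obtain rfl : j = i := Fin.ext (by omega)
        rfl
    · refine ⟨⟨k - 1, by omega⟩, LinearMap.id, fun x => funext fun j => ?_⟩
      simp only [Fin.contractNth, Function.update_apply, Fin.ext_iff, Fin.val_castSucc,
        Fin.val_succ, LinearMap.id_apply]
      split_ifs <;> first | rfl | omega

/-- The `i`-th face: `(a₀, …, aₙ₊₁) ↦ φ(a₀, …, aᵢ aᵢ₊₁, …, aₙ₊₁)`, for `0 ≤ i ≤ n`. -/
def face (n : ℕ) (i : Fin (n + 1)) : Cochain B n →ₗ[ℂ] Cochain B (n + 1) where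
  toFun φ :=
    { toFun := fun v => φ (Fin.contractNth i.castSucc (· * ·) v)
      map_update_add' := by
        intro inst v k x y
        rw [Subsingleton.elim inst (instDecidableEqFin (n + 2))]
        obtain ⟨p, L, h⟩ := contractNth_update B n i v k
        rw [h, h, h, map_add, φ.map_update_add]
      map_update_smul' := by
        intro inst v k c x
        rw [Subsingleton.elim inst (instDecidableEqFin (n + 2))]
        obtain ⟨p, L, h⟩ := contractNth_update B n i v k
        rw [h, h, map_smul, φ.map_update_smul] }
  map_add' _ _ := rfl
  map_smul' _ _ := rfl

theorem face_apply (n : ℕ) (i : Fin (n + 1)) (φ : Cochain B n) (v : Fin (n + 2) → B) :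
    face B n i φ v = φ (Fin.contractNth i.castSucc (· * ·) v) := rfl

end Faces

/-- Rotation of the arguments: `(a₀, …, aₙ) ↦ φ(aₙ, a₀, …, aₙ₋₁)`. -/
def rotate (n : ℕ) : Cochain B n →ₗ[ℂ] Cochain B n where
  toFun φ := φ.domDomCongr (finRotate (n + 1)).symm
  map_add' _ _ := rfl
  map_smul' _ _ := rfl

theorem rotate_apply (n : ℕ) (φ : Cochain B n) (v : Fin (n + 1) → B) :
    rotate B n φ v = φ fun i => v ((finRotate (n + 1)).symm i) := rfl

/-- The signed cyclic permutation
`(λφ)(a₀, …, aₙ) = (-1)ⁿ φ(aₙ, a₀, …, aₙ₋₁)`. -/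
def cyclicOp (n : ℕ) : Cochain B n →ₗ[ℂ] Cochain B n := (-1 : ℂ) ^ n • rotate B n

/-- The norm operator `N = 1 + λ + ⋯ + λⁿ`. -/
def normOp (n : ℕ) : Cochain B n →ₗ[ℂ] Cochain B n := ∑ j ∈ Finset.range (n + 1), cyclicOp B n ^ j

variable [IsScalarTower ℂ B B] [SMulCommClass ℂ B B]

/-- `(b'φ)(a₀, …, aₙ₊₁) = ∑_{i=0}^{n} (-1)ⁱ φ(a₀, …, aᵢ aᵢ₊₁, …, aₙ₊₁)`. -/
def barDiff (n : ℕ) : Cochain B n →ₗ[ℂ] Cochain B (n + 1) :=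
  ∑ i : Fin (n + 1), (-1 : ℂ) ^ (i : ℕ) • face B n i

/-- The Hochschild coboundary
`(bφ)(a₀, …, aₙ₊₁) = (b'φ)(a₀, …, aₙ₊₁) + (-1)ⁿ⁺¹ φ(aₙ₊₁ a₀, a₁, …, aₙ)`. -/
def hochschildDiff (n : ℕ) : Cochain B n →ₗ[ℂ] Cochain B (n + 1) :=
  barDiff B n + (-1 : ℂ) ^ (n + 1) • (rotate B (n + 1) ∘ₗ face B n 0)

/-- The cyclic cocycles `Z_λⁿ(B)`: forms with `λφ = φ` and `bφ = 0`. -/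
def cyclicCocycles (n : ℕ) : Submodule ℂ (Cochain B n) :=
  LinearMap.ker (1 - cyclicOp B n) ⊓ LinearMap.ker (hochschildDiff B n)

/-- The finitely supported sequences of cochains, `⨁ₙ Cⁿ(B)`. -/
def TotalCochain (B : Type*) [NonUnitalRing B] [Module ℂ B] : Type _ := ⨁ n, Cochain B n

instance (B : Type*) [NonUnitalRing B] [Module ℂ B] : AddCommGroup (TotalCochain B) :=
  inferInstanceAs (AddCommGroup (⨁ n, Cochain B n))

instance (B : Type*) [NonUnitalRing B] [Module ℂ B] : Module ℂ (TotalCochain B) :=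
  inferInstanceAs (Module ℂ (⨁ n, Cochain B n))

/-- The inclusion of `Cⁿ(B)`. -/
def TotalCochain.of (B : Type*) [NonUnitalRing B] [Module ℂ B] (n : ℕ) :
    Cochain B n →ₗ[ℂ] TotalCochain B :=
  DirectSum.lof ℂ ℕ (Cochain B) n

/-- The differential of the total complex of the two-periodic cyclic bicomplex

`⋯ → (C^•, b) --(1 - λ)--> (C^•, -b') --N--> (C^•, b) --(1 - λ)--> (C^•, -b') → ⋯`,

with finitely supported cochains. In total degree of parity `p`, the component in
`Cⁿ` sits in a column of parity `p - n`; the even columns carry `b`. -/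
def totalDiff (p : ZMod 2) : TotalCochain B →ₗ[ℂ] TotalCochain B :=
  DirectSum.toModule ℂ ℕ (TotalCochain B) fun n =>
    if (n : ZMod 2) = p then
      TotalCochain.of B (n + 1) ∘ₗ hochschildDiff B n
        + TotalCochain.of B n ∘ₗ (1 - cyclicOp B n)
    else
      -(TotalCochain.of B (n + 1) ∘ₗ barDiff B n)
        + TotalCochain.of B n ∘ₗ normOp B n

/-- On an element of `Cⁿ(B)` in an even column the differential is `bφ + (1 - λ)φ`. -/
theorem totalDiff_of_even (n : ℕ) (p : ZMod 2) (h : (n : ZMod 2) = p) (φ : Cochain B n) :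
    totalDiff B p (TotalCochain.of B n φ) =
      TotalCochain.of B (n + 1) (hochschildDiff B n φ)
        + TotalCochain.of B n ((1 - cyclicOp B n) φ) := by
  refine (DirectSum.toModule_lof ℂ (M := Cochain B) (N := TotalCochain B) n φ).trans ?_
  rw [if_pos h]
  rfl

/-- On an element of `Cⁿ(B)` in an odd column the differential is `-b'φ + Nφ`. -/
theorem totalDiff_of_odd (n : ℕ) (p : ZMod 2) (h : (n : ZMod 2) ≠ p) (φ : Cochain B n) :
    totalDiff B p (TotalCochain.of B n φ) =
      -TotalCochain.of B (n + 1) (barDiff B n φ)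
        + TotalCochain.of B n (normOp B n φ) := by
  refine (DirectSum.toModule_lof ℂ (M := Cochain B) (N := TotalCochain B) n φ).trans ?_
  rw [if_neg h]
  rfl

/-- Periodic cyclic cohomology `HP^p(B)`, `p ∈ ℤ/2`. -/
abbrev PeriodicCyclic (p : ZMod 2) : Type _ :=
  LinearMap.ker (totalDiff B p) ⧸
    (LinearMap.range (totalDiff B (p - 1))).comap (LinearMap.ker (totalDiff B p)).subtype

/-- The even periodic cyclic cohomology `HP^{ev}(B)`. -/
abbrev HPev : Type _ := PeriodicCyclic B 0

theorem cyclicCocycle_mem_ker (n : ℕ) (hn : Even n) (φ : cyclicCocycles B n) :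
    TotalCochain.of B n φ ∈ LinearMap.ker (totalDiff B 0) := by
  obtain ⟨φ, h₁, h₂⟩ := φ
  have h0 : (n : ZMod 2) = 0 := (ZMod.natCast_eq_zero_iff_even).2 hn
  replace h₁ : (1 - cyclicOp B n) φ = 0 := h₁
  replace h₂ : hochschildDiff B n φ = 0 := h₂
  rw [LinearMap.mem_ker, totalDiff_of_even B n 0 h0, h₁, h₂, map_zero, map_zero, add_zero]

/-- The class in `HP^{ev}(B)` of a cyclic cocycle of even degree. -/
def cyclicClass (n : ℕ) (hn : Even n) (φ : cyclicCocycles B n) : HPev B :=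
  Submodule.Quotient.mk ⟨TotalCochain.of B n φ, cyclicCocycle_mem_ker B n hn φ⟩

end Cyclic

/-! ### Operators on Hilbert space -/

section Operators

variable {K : Type*} [NormedAddCommGroup K] [InnerProductSpace ℂ K]

/-- The characteristic values `μ_k(T)`: the distance from `T` to the operators of
rank at most `k`. -/
def charValue (T : K →L[ℂ] K) (k : ℕ) : ℝ :=
  sInf {r : ℝ | ∃ F : K →L[ℂ] K, Module.Finite ℂ (LinearMap.range (F : K →ₗ[ℂ] K)) ∧
    Module.finrank ℂ (LinearMap.range (F : K →ₗ[ℂ] K)) ≤ k ∧ r = ‖T - F‖}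

/-- `T` is in the ideal `𝓛^{p,∞}` (`p > 1`), that is, `μ_k(T) = O(k^{-1/p})`. -/
def IsWeakSchatten (p : ℝ) (T : K →L[ℂ] K) : Prop :=
  ∃ C : ℝ, ∀ k : ℕ, charValue T k ≤ C * ((k : ℝ) + 1) ^ (-1 / p)

/-- `T` is of trace class: its characteristic values are summable. -/
def IsTraceClass (T : K →L[ℂ] K) : Prop := Summable (charValue T)

/-- The trace `∑ᵢ ⟪eᵢ, T eᵢ⟫` in a Hilbert basis; for `T` of trace class it does not
depend on the basis. -/
def opTrace [CompleteSpace K] (T : K →L[ℂ] K) : ℂ :=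
  ∑' i : (exists_hilbertBasis ℂ K).choose,
    ⟪(exists_hilbertBasis ℂ K).choose_spec.choose i,
      T ((exists_hilbertBasis ℂ K).choose_spec.choose i)⟫_ℂ

/-- `R` is the bounded two-sided inverse of `D - z`. -/
def IsResolventAt (D : K →ₗ.[ℂ] K) (z : ℂ) (R : K →L[ℂ] K) : Prop :=
  (∀ ξ : K, ∃ h : R ξ ∈ D.domain, D ⟨R ξ, h⟩ - z • R ξ = ξ) ∧
    ∀ x : D.domain, R (D x - z • (x : K)) = x

/-- `R` is the bounded inverse `D⁻¹`. -/
def IsBoundedInverse (D : K →ₗ.[ℂ] K) (R : K →L[ℂ] K) : Prop := IsResolventAt D 0 R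

/-- `D` has compact resolvent. -/
def HasCompactResolvent (D : K →ₗ.[ℂ] K) : Prop :=
  ∃ (z : ℂ) (R : K →L[ℂ] K), IsResolventAt D z R ∧ IsCompactOperator R

end Operators

/-! ### Graded twisted spectral triples -/

/-- A graded `σ`-spectral triple `(B, H, D)` over the involutive algebra `B`, where `σ` is an
algebra automorphism of `B` satisfying the unitarity condition `σ(a*) = (σ⁻¹(a))*`. -/
structure GradedTwistedTriple {B : Type*} [NonUnitalRing B] [StarRing B] [Module ℂ B]
    (σ : B ≃ₗ[ℂ] B)
    (H : Type*) [NormedAddCommGroup H] [InnerProductSpace ℂ H] [CompleteSpace H] where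
  sigma_mul : ∀ a b : B, σ (a * b) = σ a * σ b
  sigma_star : ∀ a : B, σ (star a) = star (σ.symm a)
  /-- The involutive action of `B` in `H`. -/
  π : B →⋆ₙₐ[ℂ] (H →L[ℂ] H)
  /-- The (unbounded) operator `D`. -/
  D : H →ₗ.[ℂ] H
  /-- The grading. -/
  γ : H →L[ℂ] H
  D_selfAdjoint : IsSelfAdjoint D
  D_resolvent : HasCompactResolvent D
  /-- `D a - σ(a) D` is defined on the domain of `D` and bounded there. -/
  D_bounded : ∀ a : B, ∃ T : H →L[ℂ] H, ∀ x : D.domain, ∃ h : π a x ∈ D.domain,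
    D ⟨π a x, h⟩ - π (σ a) (D x) = T x
  γ_selfAdjoint : IsSelfAdjoint γ
  γ_sq : γ * γ = 1
  γ_comm : ∀ a : B, γ * π a = π a * γ
  γ_anti : ∀ x : D.domain, ∃ h : γ x ∈ D.domain, D ⟨γ x, h⟩ = -γ (D x)

namespace GradedTwistedTriple

variable {B : Type*} [NonUnitalRing B] [StarRing B] [Module ℂ B] {σ : B ≃ₗ[ℂ] B}
  {H : Type*} [NormedAddCommGroup H] [InnerProductSpace ℂ H] [CompleteSpace H]
  (T : GradedTwistedTriple σ H)

/-- The bounded operator `d_σ a`, the closure of `D a - σ(a) D` (unique, as `D` is densely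
defined). -/
def twistedComm (a : B) : H →L[ℂ] H := (T.D_bounded a).choose

/-- The half `H_ε = {ξ | γ ξ = ε ξ}` of `H`, for a sign `ε = ±1`. -/
abbrev half (ε : ℤˣ) : Submodule ℂ H :=
  (T.γ - ((ε : ℤ) : ℂ) • (1 : H →L[ℂ] H)).ker

/-- The matrix entry `H_ε → H_δ` of a bounded operator with respect to `H = H₊ ⊕ H₋`. -/
def block (ε δ : ℤˣ) (S : H →L[ℂ] H) : T.half ε →L[ℂ] T.half δ :=
  (T.half δ).orthogonalProjectionOnto ∘L S ∘L (T.half ε).subtypeL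

/-- The operator `D_ε⁻¹ (D_ε a_ε - σ(a_{-ε}) D_ε)` on `H_ε`, where `Dinv = D⁻¹`. The second
factor maps `H_ε` to `H_{-ε}`, the first one `H_{-ε}` to `H_ε`. -/
def halfForm (Dinv : H →L[ℂ] H) (ε : ℤˣ) (a : B) : T.half ε →L[ℂ] T.half ε :=
  T.block (-ε) ε Dinv ∘L T.block ε (-ε) (T.twistedComm a)

/-- The ordered product of the operators `D_ε⁻¹ (D_ε aⁱ_ε - σ(aⁱ_{-ε}) D_ε)`, `i = 0, …, n`. -/
def halfProduct (Dinv : H →L[ℂ] H) (ε : ℤˣ) {n : ℕ} (a : Fin (n + 1) → B) :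
    T.half ε →L[ℂ] T.half ε :=
  (List.ofFn fun i => T.halfForm Dinv ε (a i)).prod

/-- The half characters
`Φ^ε(a⁰, …, aⁿ) = Tr (D_ε⁻¹ (D_ε a⁰_ε - σ(a⁰_{-ε}) D_ε) ⋯ D_ε⁻¹ (D_ε aⁿ_ε - σ(aⁿ_{-ε}) D_ε))`. -/
def halfCharacter (Dinv : H →L[ℂ] H) (ε : ℤˣ) {n : ℕ} (a : Fin (n + 1) → B) : ℂ :=
  opTrace (T.halfProduct Dinv ε a)

end GradedTwistedTriple

/-! ### One-parameter automorphism groups and their analytic elements -/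

/-- A strongly continuous one-parameter group of isometric automorphisms of an involutive
Banach algebra. -/
structure OneParamGroup (A : Type*) [NonUnitalNormedRing A] [StarRing A] [NormedSpace ℂ A] where
  /-- The automorphism `σ_t`. -/
  aut : ℝ → (A ≃⋆ₐ[ℂ] A)
  aut_zero : ∀ a : A, aut 0 a = a
  aut_add : ∀ (s t : ℝ) (a : A), aut (s + t) a = aut s (aut t a)
  norm_aut : ∀ (t : ℝ) (a : A), ‖aut t a‖ = ‖a‖
  continuous_aut : ∀ a : A, Continuous fun t => aut t a

namespace OneParamGroup

variable {A : Type*} [NonUnitalNormedRing A] [StarRing A] [NormedSpace ℂ A]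

/-- `f` is the analytic extension `z ↦ σ_z(a)` of the orbit `t ↦ σ_t(a)` (unique, by the
identity theorem). -/
def IsAnalyticExtension (U : OneParamGroup A) (a : A) (f : ℂ → A) : Prop :=
  Differentiable ℂ f ∧ ∀ t : ℝ, f t = U.aut t a

/-- The involutive subalgebra `𝒪` of the elements `a` for which `t ↦ σ_t(a)` extends to an
entire function. -/
def analyticElements [IsScalarTower ℂ A A] [SMulCommClass ℂ A A] [NormedStarGroup A]
    [StarModule ℂ A] (U : OneParamGroup A) : NonUnitalStarSubalgebra ℂ A where
  carrier := {a | ∃ f : ℂ → A, U.IsAnalyticExtension a f}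
  zero_mem' := ⟨fun _ => 0, differentiable_const _, fun t => (map_zero (U.aut t)).symm⟩
  add_mem' := by
    rintro a b ⟨f, hf, hf'⟩ ⟨g, hg, hg'⟩
    exact ⟨fun z => f z + g z, hf.add hg, fun t => by simp [hf', hg']⟩
  mul_mem' := by
    rintro a b ⟨f, hf, hf'⟩ ⟨g, hg, hg'⟩
    exact ⟨fun z => f z * g z, 
      ((ContinuousLinearMap.mul ℂ A).isBoundedBilinearMap.differentiable).comp (hf.prodMk hg),
      fun t => by simp [hf', hg']⟩
  smul_mem' := by
    rintro c a ⟨f, hf, hf'⟩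
    exact ⟨fun z => c • f z, hf.const_smul c, fun t => by simp [hf']⟩
  star_mem' := by
    rintro a ⟨f, hf, hf'⟩
    refine ⟨fun z => star (f (star z)), fun z => ?_, fun t => ?_⟩
    · have h := (hf (star z)).star_star
      rw [star_star] at h
      exact h
    · simp [hf', map_star]

/-- `σ` coincides on `𝒪` with the value at `t = -i` of the analytic extension of `(σ_t)`. -/
def OnePG [IsScalarTower ℂ A A] [SMulCommClass ℂ A A] [NormedStarGroup A] [StarModule ℂ A]
    (U : OneParamGroup A) (σ : U.analyticElements ≃ₗ[ℂ] U.analyticElements) : Prop :=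
  ∀ a : U.analyticElements, ∃ f : ℂ → A,
    U.IsAnalyticExtension (a : A) f ∧ f (-Complex.I) = (σ a : A)

end OneParamGroup

end

/-! Write `F(a) = D⁻¹ d_σ a`. Formally `F(a) = a - D⁻¹ σ(a) D`, the difference of the homomorphisms
`a ↦ a` and `a ↦ D⁻¹ σ(a) D`, both with bounded values. For such a difference, `Tr (F(a⁰) ⋯ F(aⁿ))`
is a cyclic cocycle when `n` is even, provided the trace is cyclic on the products that occur
(`traceForm_mem_cyclicCocycles`). Each `F(a)` commutes with `γ`, so the same holds for the trace
over either eigenspace.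

The two halves are linked by adjoints. The unitarity condition gives `(d_σ a*)* = -d_σ(σ⁻¹(a))`.
Conjugating `Φ⁺` therefore produces the sign `(-1)ⁿ⁺¹ = -1` and products of the operators
`d_σ(σ⁻¹(a)) D⁻¹`. Moving the last `D⁻¹` to the front exchanges the eigenspaces of `γ`, so `(Φ⁺)* =
-Φ⁻ ∘ σ⁻¹` on the nose (`conj_halfCharacter`).

It remains to see that `Φ⁻ ∘ σ⁻¹` and `Φ⁻` are cohomologous. Here `σ⁻¹ = σ_i` is joined to the
identity by the flow `σ_{ti}`, `0 ≤ t ≤ 1`, whose generator is a derivation, and Lie derivatives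
along derivations vanish in periodic cyclic cohomology (`of_lieDeriv_mem_range`,
`of_compLinearMap_sub_mem_range`).

Two analytic points carry this. First, traces: membership in `𝓛^{n,∞}` is restated as approximation
by operators of rank `O(2ˡ)` with error `O(2^{-l/n})`. Rates multiply under products, a rate below
`1/2` gives nuclearity, and `Tr AB = Tr BA` holds even if neither factor is of trace class
(`DyadicApprox.opTrace_comm`). Second, `t ↦ Φ⁻(σ_{ti}(a⁰), …)` must be differentiable although no
continuity of `a ↦ d_σ a` is assumed. That map is closed with respect to `a` and `σ(a)`, and the
closed graph theorem on an `ℓ¹` space of superpositions of Taylor remainders gives the estimate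
needed (`hasDerivAt_flow_of_closed`). -/

noncomputable section

open InnerProductSpace

/-! ### Nuclear operators and their trace -/

section Nuclear

variable {K : Type*} [NormedAddCommGroup K] [InnerProductSpace ℂ K]
  {L : Type*} [NormedAddCommGroup L] [InnerProductSpace ℂ L]
  {M : Type*} [NormedAddCommGroup M] [InnerProductSpace ℂ M]

/-- `T` is a sum of operators of rank one with norms adding up to at most `c`. -/
def NuclearBound (T : K →L[ℂ] L) (c : ℝ) : Prop :=
  ∃ (ι : Type) (x : ι → L) (y : ι → K), Summable (fun j => ‖x j‖ * ‖y j‖) ∧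
    ∑' j, ‖x j‖ * ‖y j‖ ≤ c ∧ HasSum (fun j => rankOne ℂ (x j) (y j)) T

theorem HilbertBasis.tsum_norm_inner_mul_le {κ : Type*} (b : HilbertBasis κ ℂ K) (x y : K) :
    Summable (fun i => ‖⟪b i, x⟫_ℂ‖ * ‖⟪b i, y⟫_ℂ‖) ∧
      ∑' i, ‖⟪b i, x⟫_ℂ‖ * ‖⟪b i, y⟫_ℂ‖ ≤ ‖x‖ * ‖y‖ := by
  have hs : ∀ z : K, Summable (fun i => ‖⟪b i, z⟫_ℂ‖ ^ (2 : ℝ)) ∧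
      ∑' i, ‖⟪b i, z⟫_ℂ‖ ^ (2 : ℝ) ≤ ‖z‖ ^ 2 := fun z => by
    simp only [Real.rpow_two]
    exact ⟨b.orthonormal.inner_products_summable z, b.orthonormal.tsum_inner_products_le z⟩
  have hpq : (2 : ℝ).HolderConjugate 2 := Real.holderConjugate_iff.2 ⟨by norm_num, by norm_num⟩
  refine ⟨Real.summable_mul_of_Lp_Lq_of_nonneg hpq (fun i => norm_nonneg ⟪b i, x⟫_ℂ)
    (fun i => norm_nonneg ⟪b i, y⟫_ℂ) (hs x).1 (hs y).1,
    (Real.inner_le_Lp_mul_Lq_tsum_of_nonneg hpq (fun i => norm_nonneg ⟪b i, x⟫_ℂ)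
    (fun i => norm_nonneg ⟪b i, y⟫_ℂ) (hs x).1 (hs y).1).trans ?_⟩
  have h2 : ∀ z : K, (∑' i, ‖⟪b i, z⟫_ℂ‖ ^ (2 : ℝ)) ^ (1 / 2 : ℝ) ≤ ‖z‖ := fun z => by
    rw [← Real.sqrt_eq_rpow]
    exact Real.sqrt_le_iff.2 ⟨norm_nonneg z, (hs z).2⟩
  exact mul_le_mul (h2 x) (h2 y) (by positivity) (norm_nonneg x)

/-- Fubini for the double family `⟪yⱼ, bᵢ⟫ ⟪bᵢ, xⱼ⟫`, absolutely summable by Cauchy–Schwarz in `i`: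
Parseval evaluates the sum over `i` first, the expansion of `T` the sum over `j` first. The
right-hand side does not involve the basis. -/
theorem HilbertBasis.hasSum_inner_of_hasSum_rankOne {κ : Type*} (b : HilbertBasis κ ℂ K)
    {ι : Type*} {x y : ι → K} (h : Summable fun j => ‖x j‖ * ‖y j‖) {T : K →L[ℂ] K}
    (hT : HasSum (fun j => rankOne ℂ (x j) (y j)) T) :
    HasSum (fun i => ⟪b i, T (b i)⟫_ℂ) (∑' j, ⟪y j, x j⟫_ℂ) := by
  set f : ι × κ → ℂ := fun p => ⟪y p.1, b p.2⟫_ℂ * ⟪b p.2, x p.1⟫_ℂ with hf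
  have hnf : ∀ j i, ‖f (j, i)‖ = ‖⟪b i, x j⟫_ℂ‖ * ‖⟪b i, y j⟫_ℂ‖ := fun j i => by
    simp only [hf, norm_mul]
    rw [norm_inner_symm (y j), mul_comm]
  have hsf : Summable f := by
    refine Summable.of_norm ((summable_prod_of_nonneg fun _ => norm_nonneg _).2 ⟨fun j => ?_, ?_⟩)
    · simp only [hnf]
      exact (b.tsum_norm_inner_mul_le _ _).1
    · refine Summable.of_nonneg_of_le (fun j => tsum_nonneg fun _ => norm_nonneg _) (fun j => ?_) h
      simp only [hnf]
      exact (b.tsum_norm_inner_mul_le _ _).2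
  have h1 : HasSum f (∑' j, ⟪y j, x j⟫_ℂ) := by
    rw [hsf.hasSum_iff, hsf.tsum_prod]
    exact tsum_congr fun j => b.tsum_inner_mul_inner (y j) (x j)
  have h2 : HasSum (f ∘ (Equiv.prodComm κ ι)) (∑' j, ⟪y j, x j⟫_ℂ) :=
    (Equiv.hasSum_iff _).2 h1
  refine h2.prod_fiberwise fun i => ?_
  have h3 := (((innerSL ℂ (b i)) ∘L ContinuousLinearMap.apply ℂ K (b i)) : (K →L[ℂ] K) →L[ℂ] ℂ).hasSum hT
  simpa [hf, Function.comp_def] using h3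

theorem opTrace_eq_of_hasSum_rankOne [CompleteSpace K] {ι : Type*} {x y : ι → K}
    (h : Summable fun j => ‖x j‖ * ‖y j‖) {T : K →L[ℂ] K}
    (hT : HasSum (fun j => rankOne ℂ (x j) (y j)) T) : opTrace T = ∑' j, ⟪y j, x j⟫_ℂ :=
  (HilbertBasis.hasSum_inner_of_hasSum_rankOne _ h hT).tsum_eq

namespace NuclearBound

theorem mono {T : K →L[ℂ] L} {c c' : ℝ} (h : NuclearBound T c) (hc : c ≤ c') :
    NuclearBound T c' := by
  obtain ⟨ι, x, y, h1, h2, h3⟩ := h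
  exact ⟨ι, x, y, h1, h2.trans hc, h3⟩

theorem comp_left {T : K →L[ℂ] L} {c : ℝ} (h : NuclearBound T c) (A : L →L[ℂ] M) :
    NuclearBound (A ∘L T) (‖A‖ * c) := by
  obtain ⟨ι, x, y, h1, h2, h3⟩ := h
  have hle : ∀ j, ‖A (x j)‖ * ‖y j‖ ≤ ‖A‖ * (‖x j‖ * ‖y j‖) := fun j => by
    rw [← mul_assoc]
    exact mul_le_mul_of_nonneg_right (A.le_opNorm _) (norm_nonneg _)
  have hs : Summable fun j => ‖A (x j)‖ * ‖y j‖ :=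
    Summable.of_nonneg_of_le (fun j => by positivity) hle (h1.mul_left ‖A‖)
  refine ⟨ι, fun j => A (x j), y, hs, ?_, ?_⟩
  · refine (hs.tsum_le_tsum hle (h1.mul_left ‖A‖)).trans ?_
    rw [tsum_mul_left]
    exact mul_le_mul_of_nonneg_left h2 (norm_nonneg _)
  · simpa [comp_rankOne] using (ContinuousLinearMap.compL ℂ K L M A).hasSum h3

theorem comp_right [CompleteSpace K] [CompleteSpace M] {T : K →L[ℂ] L} {c : ℝ}
    (h : NuclearBound T c) (A : M →L[ℂ] K) : NuclearBound (T ∘L A) (‖A‖ * c) := by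
  obtain ⟨ι, x, y, h1, h2, h3⟩ := h
  have hle : ∀ j, ‖x j‖ * ‖A.adjoint (y j)‖ ≤ ‖A‖ * (‖x j‖ * ‖y j‖) := fun j => by
    have := (A.adjoint).le_opNorm (y j)
    rw [LinearIsometryEquiv.norm_map] at this
    nlinarith [norm_nonneg (x j)]
  have hs : Summable fun j => ‖x j‖ * ‖A.adjoint (y j)‖ :=
    Summable.of_nonneg_of_le (fun j => by positivity) hle (h1.mul_left ‖A‖)
  refine ⟨ι, x, fun j => A.adjoint (y j), hs, ?_, ?_⟩
  · refine (hs.tsum_le_tsum hle (h1.mul_left ‖A‖)).trans ?_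
    rw [tsum_mul_left]
    exact mul_le_mul_of_nonneg_left h2 (norm_nonneg _)
  · have := ((ContinuousLinearMap.compL ℂ M K L).flip A).hasSum h3
    simpa [rankOne_comp] using this

theorem sum [CompleteSpace L] {T : ℕ → K →L[ℂ] L} {c : ℕ → ℝ} (h : ∀ k, NuclearBound (T k) (c k))
    (hc : Summable c) {S : K →L[ℂ] L} (hS : HasSum T S) : NuclearBound S (∑' k, c k) := by
  choose ι x y h1 h2 h3 using h
  have hs : Summable fun p : (k : ℕ) × ι k => ‖x p.1 p.2‖ * ‖y p.1 p.2‖ := by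
    refine (summable_sigma_of_nonneg fun _ => by positivity).2 ⟨h1, ?_⟩
    exact Summable.of_nonneg_of_le (fun k => tsum_nonneg fun _ => by positivity) h2 hc
  refine ⟨(k : ℕ) × ι k, fun p => x p.1 p.2, fun p => y p.1 p.2, hs, ?_, ?_⟩
  · rw [hs.tsum_sigma]
    exact (Summable.of_nonneg_of_le (fun k => tsum_nonneg fun _ => by positivity) h2 hc).tsum_le_tsum
      h2 hc
  · have hs' : Summable fun p : (k : ℕ) × ι k => ‖rankOne ℂ (x p.1 p.2) (y p.1 p.2)‖ := by
      simpa using hs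
    have h4 := hs'.of_norm.hasSum
    rwa [(h4.sigma h3).unique hS] at h4

theorem hasSum_inner [CompleteSpace K] {T : K →L[ℂ] K} {c : ℝ} (h : NuclearBound T c)
    {κ : Type*} (b : HilbertBasis κ ℂ K) : HasSum (fun i => ⟪b i, T (b i)⟫_ℂ) (opTrace T) := by
  obtain ⟨ι, x, y, h1, h2, h3⟩ := h
  rw [opTrace_eq_of_hasSum_rankOne h1 h3]
  exact b.hasSum_inner_of_hasSum_rankOne h1 h3

theorem norm_opTrace_le [CompleteSpace K] {T : K →L[ℂ] K} {c : ℝ} (h : NuclearBound T c) :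
    ‖opTrace T‖ ≤ c := by
  obtain ⟨ι, x, y, h1, h2, h3⟩ := h
  rw [opTrace_eq_of_hasSum_rankOne h1 h3]
  refine (tsum_of_norm_bounded h1.hasSum fun j => ?_).trans h2
  rw [mul_comm]
  exact norm_inner_le_norm _ _

theorem opTrace_add [CompleteSpace K] {S T : K →L[ℂ] K} {c d : ℝ} (hS : NuclearBound S c)
    (hT : NuclearBound T d) : opTrace (S + T) = opTrace S + opTrace T := by
  refine HasSum.tsum_eq ?_
  simpa [inner_add_right] using (hS.hasSum_inner _).add (hT.hasSum_inner _)

/-- On rank-one terms this is `⟪y, A x⟫ = ⟪A* y, x⟫`. The two spaces may differ, which is needed for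
the inclusion of an eigenspace of the grading. -/
theorem opTrace_comm [CompleteSpace K] [CompleteSpace L] {T : K →L[ℂ] L} {c : ℝ}
    (h : NuclearBound T c) (A : L →L[ℂ] K) : opTrace (A ∘L T) = opTrace (T ∘L A) := by
  obtain ⟨ι, x, y, h1, h2, h3⟩ := h
  have h4 : HasSum (fun j => rankOne ℂ (A (x j)) (y j)) (A ∘L T) := by
    simpa [comp_rankOne] using (ContinuousLinearMap.compL ℂ K L K A).hasSum h3
  have h5 : HasSum (fun j => rankOne ℂ (x j) (A.adjoint (y j))) (T ∘L A) := by
    simpa [rankOne_comp] using ((ContinuousLinearMap.compL ℂ L K L).flip A).hasSum h3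
  rw [opTrace_eq_of_hasSum_rankOne (h1.mul_left ‖A‖ |>.of_nonneg_of_le (fun j => by positivity)
      fun j => ?_) h4, opTrace_eq_of_hasSum_rankOne (h1.mul_left ‖A‖ |>.of_nonneg_of_le
      (fun j => by positivity) fun j => ?_) h5]
  · simp only [ContinuousLinearMap.adjoint_inner_left]
  · have := (A.adjoint).le_opNorm (y j)
    rw [LinearIsometryEquiv.norm_map] at this
    nlinarith [norm_nonneg (x j)]
  · rw [← mul_assoc]
    exact mul_le_mul_of_nonneg_right (A.le_opNorm _) (norm_nonneg _)

theorem opTrace_smul [CompleteSpace K] {T : K →L[ℂ] K} (z : ℂ) :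
    opTrace (z • T) = z * opTrace T := by
  simp only [opTrace, _root_.smul_apply, inner_smul_right, tsum_mul_left]

theorem zero : NuclearBound (0 : K →L[ℂ] L) 0 :=
  ⟨Empty, Empty.elim, Empty.elim, summable_empty, by simp, by simp⟩

theorem smul {T : K →L[ℂ] L} {c : ℝ} (h : NuclearBound T c) (z : ℂ) :
    NuclearBound (z • T) (‖z‖ * c) := by
  obtain ⟨ι, x, y, h1, h2, h3⟩ := h
  refine ⟨ι, fun j => z • x j, y, ?_, ?_, ?_⟩
  · simpa [norm_smul, mul_assoc] using h1.mul_left ‖z‖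
  · simpa [norm_smul, mul_assoc, tsum_mul_left] using mul_le_mul_of_nonneg_left h2 (norm_nonneg z)
  · simpa using h3.const_smul z

theorem add {S T : K →L[ℂ] L} {c d : ℝ} (hS : NuclearBound S c) (hT : NuclearBound T d) :
    NuclearBound (S + T) (c + d) := by
  obtain ⟨ι, x, y, h1, h2, h3⟩ := hS
  obtain ⟨ι', x', y', h1', h2', h3'⟩ := hT
  refine ⟨ι ⊕ ι', Sum.elim x x', Sum.elim y y', ?_, ?_, ?_⟩
  · exact (HasSum.sum (f := fun j => ‖Sum.elim x x' j‖ * ‖Sum.elim y y' j‖)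
      h1.hasSum h1'.hasSum).summable
  · refine le_of_eq_of_le (HasSum.tsum_eq (HasSum.sum
      (f := fun j => ‖Sum.elim x x' j‖ * ‖Sum.elim y y' j‖) h1.hasSum h1'.hasSum)) (add_le_add h2 h2')
  · exact HasSum.sum (f := fun j => rankOne ℂ (Sum.elim x x' j) (Sum.elim y y' j)) h3 h3'

theorem of_finrank_range_le [CompleteSpace K] [CompleteSpace L] {F : K →L[ℂ] L} {r : ℕ}
    [Module.Finite ℂ (LinearMap.range (F : K →ₗ[ℂ] L))]
    (hr : Module.finrank ℂ (LinearMap.range (F : K →ₗ[ℂ] L)) ≤ r) :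
    NuclearBound F (r * ‖F‖) := by
  set V := LinearMap.range (F : K →ₗ[ℂ] L)
  set e := stdOrthonormalBasis ℂ V
  -- Expand `F v` in an orthonormal basis of the range; the coefficient `⟪eᵢ, F v⟫` equals `⟪F* eᵢ,
  -- v⟫`.
  have hF : ∑ i, rankOne ℂ ((e i : V) : L) (F.adjoint (e i)) = F := by
    ext v
    have h := e.sum_repr' ⟨F v, LinearMap.mem_range_self (F : K →ₗ[ℂ] L) v⟩
    have h' := congrArg (Subtype.val) h
    simpa [ContinuousLinearMap.adjoint_inner_left] using h'
  have hle : ∀ i, ‖((e i : V) : L)‖ * ‖F.adjoint (e i)‖ ≤ ‖F‖ := fun i => by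
    have h1 : ‖((e i : V) : L)‖ = 1 := e.norm_eq_one i
    have := (F.adjoint).le_opNorm (e i)
    rwa [LinearIsometryEquiv.norm_map, h1, mul_one, ← one_mul ‖_‖, ← h1] at this
  refine ⟨Fin (Module.finrank ℂ V), fun i => (e i : V), fun i => F.adjoint (e i),
    (hasSum_fintype _).summable, ?_, ?_⟩
  · rw [tsum_fintype]
    refine (Finset.sum_le_card_nsmul _ _ _ fun i _ => hle i).trans ?_
    simp only [Finset.card_univ, Fintype.card_fin, nsmul_eq_mul]
    gcongr
  · convert hasSum_fintype _
    exact hF.symm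

end NuclearBound

theorem opTrace_adjoint [CompleteSpace K] (T : K →L[ℂ] K) :
    opTrace T.adjoint = conj (opTrace T) := by
  rw [opTrace, opTrace, Complex.conj_tsum]
  refine tsum_congr fun i => ?_
  rw [ContinuousLinearMap.adjoint_inner_right, inner_conj_symm]

end Nuclear

/-! ### Dyadic approximation by finite-rank operators, and characteristic values -/

section DyadicApprox

universe u

variable {K : Type u} [NormedAddCommGroup K] [InnerProductSpace ℂ K]
  {L : Type u} [NormedAddCommGroup L] [InnerProductSpace ℂ L]

/-- `A` is approximated by operators `W l` of rank at most `M 2ˡ`, with `W 0 = 0`, up to an error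
of at most `C sˡ`. -/
def DyadicApprox (M : ℕ) (C s : ℝ) (A : K →L[ℂ] K) : Prop :=
  ∃ W : ℕ → K →L[ℂ] K, W 0 = 0 ∧
    (∀ l, (W l : K →ₗ[ℂ] K).rank ≤ ((M * 2 ^ l : ℕ) : Cardinal.{u})) ∧
    ∀ l, ‖A - W l‖ ≤ C * s ^ l

theorem finrank_range_le_of_rank_le {F : K →L[ℂ] K} {r : ℕ}
    (h : (F : K →ₗ[ℂ] K).rank ≤ (r : Cardinal.{u})) :
    Module.Finite ℂ (LinearMap.range (F : K →ₗ[ℂ] K)) ∧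
      Module.finrank ℂ (LinearMap.range (F : K →ₗ[ℂ] K)) ≤ r := by
  have h1 : Module.Finite ℂ (LinearMap.range (F : K →ₗ[ℂ] K)) :=
    Module.rank_lt_aleph0_iff.1 (h.trans_lt (Cardinal.natCast_lt_aleph0))
  refine ⟨h1, ?_⟩
  rw [LinearMap.rank, ← Module.finrank_eq_rank] at h
  exact_mod_cast h

theorem ContinuousLinearMap.rank_add_le_natCast {F G : K →L[ℂ] K} {m n : ℕ}
    (hF : (F : K →ₗ[ℂ] K).rank ≤ (m : Cardinal.{u})) (hG : (G : K →ₗ[ℂ] K).rank ≤ (n : Cardinal.{u})) :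
    ((F + G : K →L[ℂ] K) : K →ₗ[ℂ] K).rank ≤ ((m + n : ℕ) : Cardinal.{u}) := by
  rw [ContinuousLinearMap.toLinearMap_add]
  push_cast
  exact (LinearMap.rank_add_le _ _).trans (add_le_add hF hG)

theorem ContinuousLinearMap.rank_neg_le_natCast {F : K →L[ℂ] K} {m : ℕ}
    (hF : (F : K →ₗ[ℂ] K).rank ≤ (m : Cardinal.{u})) :
    ((-F : K →L[ℂ] K) : K →ₗ[ℂ] K).rank ≤ (m : Cardinal.{u}) := by
  have : ((-F : K →L[ℂ] K) : K →ₗ[ℂ] K) = (-LinearMap.id) ∘ₗ (F : K →ₗ[ℂ] K) := by ext; simp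
  rw [this]
  exact (LinearMap.rank_comp_le_right _ _).trans hF

theorem ContinuousLinearMap.rank_sub_le_natCast {F G : K →L[ℂ] K} {m n : ℕ}
    (hF : (F : K →ₗ[ℂ] K).rank ≤ (m : Cardinal.{u})) (hG : (G : K →ₗ[ℂ] K).rank ≤ (n : Cardinal.{u})) :
    ((F - G : K →L[ℂ] K) : K →ₗ[ℂ] K).rank ≤ ((m + n : ℕ) : Cardinal.{u}) := by
  rw [sub_eq_add_neg]
  exact rank_add_le_natCast hF (rank_neg_le_natCast hG)

namespace DyadicApprox

variable {M M' : ℕ} {C C' s s' : ℝ} {A B : K →L[ℂ] K}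

theorem of_bounded (A : K →L[ℂ] K) : DyadicApprox 0 ‖A‖ 1 A :=
  ⟨fun _ => 0, rfl, fun l => by simp [LinearMap.rank_zero], fun l => by simp⟩

theorem norm_le (h : DyadicApprox M C s A) : ‖A‖ ≤ C := by
  obtain ⟨W, h0, -, hW⟩ := h
  simpa [h0] using hW 0

/-- With `V`, `W` approximating `A`, `B`, the operator `V B + (A - V) W` leaves the error `(A - V)(B
- W)`: ranks add while errors, hence rates, multiply. -/
theorem mul (hA : DyadicApprox M C s A) (hB : DyadicApprox M' C' s' B) (hs : 0 ≤ s) :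
    DyadicApprox (M + M') (C * C') (s * s') (A * B) := by
  have hC : 0 ≤ C := (norm_nonneg A).trans hA.norm_le
  obtain ⟨V, hV0, hV, hVn⟩ := hA
  obtain ⟨W, hW0, hW, hWn⟩ := hB
  refine ⟨fun l => V l * B + (A - V l) * W l, by simp [hV0, hW0], fun l => ?_, fun l => ?_⟩
  · rw [add_mul]
    exact ContinuousLinearMap.rank_add_le_natCast ((LinearMap.rank_comp_le_left _ _).trans (hV l))
      ((LinearMap.rank_comp_le_right _ _).trans (hW l))
  · have : A * B - (V l * B + (A - V l) * W l) = (A - V l) * (B - W l) := by noncomm_ring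
    rw [this, mul_pow, mul_mul_mul_comm]
    exact (norm_mul_le _ _).trans (mul_le_mul (hVn l) (hWn l) (norm_nonneg _) (by positivity))

theorem compress (hA : DyadicApprox M C s A) (p : K →L[ℂ] L) (i : L →L[ℂ] K) (hp : ‖p‖ ≤ 1)
    (hi : ‖i‖ ≤ 1) : DyadicApprox M C s (p ∘L A ∘L i) := by
  obtain ⟨W, h0, hr, hW⟩ := hA
  refine ⟨fun l => p ∘L W l ∘L i, by simp [h0], fun l => ?_, fun l => ?_⟩
  · exact (LinearMap.rank_comp_le_right _ _).trans ((LinearMap.rank_comp_le_left _ _).trans (hr l))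
  · have : p ∘L A ∘L i - p ∘L W l ∘L i = p ∘L (A - W l) ∘L i := by ext; simp
    rw [this]
    refine le_trans ?_ (hW l)
    refine (ContinuousLinearMap.opNorm_comp_le _ _).trans ?_
    refine (mul_le_of_le_one_left (norm_nonneg _) hp).trans ?_
    exact (ContinuousLinearMap.opNorm_comp_le _ _).trans (mul_le_of_le_one_right (norm_nonneg _) hi)

/-- Telescope `A = ∑ (W (l+1) - W l)`. A term has rank at most `3M 2ˡ` and norm at most `2C sˡ`, so
its nuclear bound is `6MC (2s)ˡ`, a convergent geometric series for `s < 1/2`. -/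
theorem nuclearBound [CompleteSpace K] (h : DyadicApprox M C s A) (hs : 0 ≤ s) (hs2 : s < 1 / 2) :
    NuclearBound A (C * (6 * M * (1 - 2 * s)⁻¹)) := by
  have hC : 0 ≤ C := (norm_nonneg A).trans h.norm_le
  obtain ⟨W, h0, hr, hW⟩ := h
  have hn : ∀ l, ‖W (l + 1) - W l‖ ≤ 2 * C * s ^ l := fun l => by
    have h1 : W (l + 1) - W l = (A - W l) - (A - W (l + 1)) := by abel
    have h2 : C * s ^ (l + 1) ≤ C * s ^ l :=
      mul_le_mul_of_nonneg_left (pow_le_pow_of_le_one hs (by linarith) l.le_succ) hC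
    rw [h1]
    exact (norm_sub_le _ _).trans (by linarith [hW l, hW (l + 1)])
  have hnuc : ∀ l, NuclearBound (W (l + 1) - W l) (6 * M * C * (2 * s) ^ l) := fun l => by
    obtain ⟨h1, h2⟩ := finrank_range_le_of_rank_le
      (ContinuousLinearMap.rank_sub_le_natCast (hr (l + 1)) (hr l))
    refine (NuclearBound.of_finrank_range_le h2).mono ?_
    refine (mul_le_mul_of_nonneg_left (hn l) (by positivity)).trans (le_of_eq ?_)
    push_cast
    rw [mul_pow, pow_succ]
    ring
  have hg : HasSum (fun l => 6 * M * C * (2 * s) ^ l) (6 * M * C * (1 - 2 * s)⁻¹) :=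
    (hasSum_geometric_of_lt_one (by positivity) (by linarith)).mul_left _
  have hsum : Summable fun l => ‖W (l + 1) - W l‖ :=
    Summable.of_nonneg_of_le (fun _ => norm_nonneg _) hn
      ((summable_geometric_of_lt_one hs (by linarith)).mul_left _)
  have hlim : Filter.Tendsto W Filter.atTop (nhds A) := by
    rw [tendsto_iff_norm_sub_tendsto_zero]
    refine squeeze_zero (fun _ => norm_nonneg _) (fun l => ?_)
      (by simpa using (tendsto_pow_atTop_nhds_zero_of_lt_one hs (by linarith)).const_mul C)
    rw [norm_sub_rev]
    exact hW l
  have hS : HasSum (fun l => W (l + 1) - W l) A := by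
    rw [hsum.of_norm.hasSum_iff_tendsto_nat]
    simp only [Finset.sum_range_sub, h0, sub_zero]
    exact hlim
  refine (NuclearBound.sum hnuc hg.summable hS).mono (le_of_eq ?_)
  rw [hg.tsum_eq]
  ring

/-- Subtracting one of the approximants makes the constant small, at a slightly worse rate. -/
theorem sub_approximant {W : ℕ → K →L[ℂ] K}
    (hr : ∀ l, (W l : K →ₗ[ℂ] K).rank ≤ ((M * 2 ^ l : ℕ) : Cardinal.{u}))
    (hW : ∀ l, ‖A - W l‖ ≤ C * s ^ l) (hC : 0 ≤ C) (hs : 0 ≤ s) {r : ℝ} (hsr : s < r) (hr1 : r ≤ 1)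
    (k : ℕ) : DyadicApprox (M + M) (C * (s / r) ^ k) r (A - W k) := by
  have hr0 : 0 < r := hs.trans_lt hsr
  have hq : s / r ≤ 1 := (div_le_one hr0).2 hsr.le
  have hsl : ∀ l, s ^ l = (s / r) ^ l * r ^ l := fun l => by
    rw [← mul_pow, div_mul_cancel₀ _ hr0.ne']
  -- Below level `k` the operator `A - W k` is already small enough: `C sᵏ ≤ C (s/r)ᵏ rˡ` for `l <
  -- k`. From level `k` on, `W l - W k` has the error of `W l`, and `(s/r)ˡ ≤ (s/r)ᵏ`.
  refine ⟨fun l => if l < k then 0 else W l - W k, ?_, fun l => ?_, fun l => ?_⟩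
  · rcases Nat.eq_zero_or_pos k with rfl | hk
    · simp
    · simp [hk]
  · dsimp only
    split_ifs with h
    · simp [LinearMap.rank_zero]
    · rw [add_mul]
      refine ContinuousLinearMap.rank_sub_le_natCast (hr l) ((hr k).trans ?_)
      exact_mod_cast Nat.mul_le_mul_left M (Nat.pow_le_pow_right (by norm_num) (not_lt.1 h))
  · dsimp only
    split_ifs with h
    · rw [sub_zero]
      refine (hW k).trans ?_
      rw [hsl, mul_assoc]
      have := pow_le_pow_of_le_one hr0.le hr1 h.le
      gcongr
    · rw [sub_sub_sub_cancel_right]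
      refine (hW l).trans ?_
      rw [hsl, mul_assoc]
      have := pow_le_pow_of_le_one (div_nonneg hs hr0.le) hq (not_lt.1 h)
      gcongr

/-- Split off the finite-rank operator `W k` from `A`. For it the trace commutes, and the remainders
`(A - W k) B` and `B (A - W k)` have nuclear bounds tending to zero with `k`. Only the rate of the
product has to be below `1/2`. -/
theorem opTrace_comm [CompleteSpace K] (hA : DyadicApprox M C s A) (hB : DyadicApprox M' C' s' B)
    (hs : 0 ≤ s) (hs1 : s < 1) (hs' : 0 < s') (hss : s * s' < 1 / 2) :
    opTrace (A * B) = opTrace (B * A) := by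
  have hC : 0 ≤ C := (norm_nonneg A).trans hA.norm_le
  -- A rate slightly worse than `s` that still satisfies `r s' < 1/2`; the loss pays for the
  -- decaying factor `(s/r)ᵏ`.
  obtain ⟨r, hsr, hr⟩ := exists_between (lt_min hs1 (show s < 1 / 2 / s' by rwa [lt_div_iff₀ hs']))
  have hr1 : r ≤ 1 := (hr.trans_le (min_le_left _ _)).le
  have hrs : r * s' < 1 / 2 := by
    have := hr.trans_le (min_le_right _ _)
    rwa [lt_div_iff₀ hs'] at this
  have hr0 : 0 < r := hs.trans_lt hsr
  obtain ⟨W, h0, hrk, hW⟩ := hA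
  set c : ℝ := C * C' * (6 * (M + M + M' : ℕ) * (1 - 2 * (r * s'))⁻¹) with hc
  have key : ∀ k, ‖opTrace (A * B) - opTrace (B * A)‖ ≤ 2 * c * (s / r) ^ k := fun k => by
    obtain ⟨f1, f2⟩ := finrank_range_le_of_rank_le (hrk k)
    have hn := NuclearBound.of_finrank_range_le f2
    have hd := sub_approximant hrk hW hC hs hsr hr1 k
    have h3 := (hd.mul hB hr0.le).nuclearBound (by positivity) hrs
    have h4 := (hB.mul hd hs'.le).nuclearBound (by positivity) (by linarith [mul_comm r s'])
    have e1 : opTrace (A * B) = opTrace ((A - W k) * B) + opTrace (W k * B) := by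
      rw [← NuclearBound.opTrace_add h3 (T := W k * B) (hn.comp_right B), ← add_mul,
        sub_add_cancel]
    have e2 : opTrace (B * A) = opTrace (B * (A - W k)) + opTrace (B * W k) := by
      rw [← NuclearBound.opTrace_add h4 (T := B * W k) (hn.comp_left B), ← mul_add,
        sub_add_cancel]
    have e3 : opTrace (W k * B) = opTrace (B * W k) := (hn.opTrace_comm B).symm
    rw [e1, e2, e3, add_sub_add_right_eq_sub]
    refine (norm_sub_le _ _).trans ((add_le_add h3.norm_opTrace_le h4.norm_opTrace_le).trans
      (le_of_eq ?_))
    rw [hc, mul_comm s' r, Nat.add_comm M' (M + M)]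
    ring
  have hlim : Filter.Tendsto (fun k => 2 * c * (s / r) ^ k) Filter.atTop (nhds 0) := by
    simpa using (tendsto_pow_atTop_nhds_zero_of_lt_one (div_nonneg hs hr0.le)
      ((div_lt_one hr0).2 hsr)).const_mul (2 * c)
  have := ge_of_tendsto' hlim key
  exact sub_eq_zero.1 (norm_le_zero_iff.1 this)

end DyadicApprox

theorem charValue_set_bddBelow (T : K →L[ℂ] K) (k : ℕ) :
    BddBelow {r : ℝ | ∃ F : K →L[ℂ] K, Module.Finite ℂ (LinearMap.range (F : K →ₗ[ℂ] K)) ∧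
      Module.finrank ℂ (LinearMap.range (F : K →ₗ[ℂ] K)) ≤ k ∧ r = ‖T - F‖} :=
  ⟨0, by rintro r ⟨F, -, -, rfl⟩; exact norm_nonneg _⟩

theorem charValue_set_nonempty (T : K →L[ℂ] K) (k : ℕ) :
    {r : ℝ | ∃ F : K →L[ℂ] K, Module.Finite ℂ (LinearMap.range (F : K →ₗ[ℂ] K)) ∧
      Module.finrank ℂ (LinearMap.range (F : K →ₗ[ℂ] K)) ≤ k ∧ r = ‖T - F‖}.Nonempty := by
  obtain ⟨h1, h2⟩ := finrank_range_le_of_rank_le (F := (0 : K →L[ℂ] K)) (r := k)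
    (by simp [LinearMap.rank_zero])
  exact ⟨_, 0, h1, h2, rfl⟩

theorem charValue_nonneg (T : K →L[ℂ] K) (k : ℕ) : 0 ≤ charValue T k :=
  Real.sInf_nonneg (by rintro r ⟨F, -, -, rfl⟩; exact norm_nonneg _)

theorem charValue_antitone (T : K →L[ℂ] K) : Antitone (charValue T) := fun j k hjk =>
  csInf_le_csInf (charValue_set_bddBelow T k) (charValue_set_nonempty T j)
    (by rintro r ⟨F, h1, h2, rfl⟩; exact ⟨F, h1, h2.trans hjk, rfl⟩)

theorem charValue_le {T F : K →L[ℂ] K} {k : ℕ}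
    (hF : (F : K →ₗ[ℂ] K).rank ≤ (k : Cardinal.{u})) : charValue T k ≤ ‖T - F‖ :=
  csInf_le (charValue_set_bddBelow T k) ⟨F, (finrank_range_le_of_rank_le hF).1,
    (finrank_range_le_of_rank_le hF).2, rfl⟩

theorem DyadicApprox.isTraceClass {M : ℕ} {C s : ℝ} {A : K →L[ℂ] K} (h : DyadicApprox M C s A)
    (hs : 0 ≤ s) (hs2 : s < 1 / 2) : IsTraceClass A := by
  have hC : 0 ≤ C := (norm_nonneg A).trans h.norm_le
  obtain ⟨W, h0, hr, hW⟩ := h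
  obtain ⟨m, hm⟩ : ∃ m, M ≤ 2 ^ m := ⟨M, Nat.lt_two_pow_self.le⟩
  -- Cauchy condensation. The shift by `m`, with `M ≤ 2ᵐ`, makes rank `M 2ˡ` admissible for the
  -- characteristic value of index `2^{l+m}`.
  refine (summable_condensed_iff_of_nonneg (charValue_nonneg A)
    fun {j k} _ hjk => charValue_antitone A hjk).1 ?_
  rw [← summable_nat_add_iff m]
  refine Summable.of_nonneg_of_le (fun l => mul_nonneg (by positivity) (charValue_nonneg _ _))
    (fun l => ?_) ((summable_geometric_of_lt_one (r := 2 * s) (by positivity)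
      (by linarith)).mul_left (2 ^ m * C))
  have h1 : charValue A (2 ^ (l + m)) ≤ C * s ^ l := by
    refine le_trans (charValue_antitone A ?_) ((charValue_le (hr l)).trans (hW l))
    rw [pow_add, mul_comm]
    exact Nat.mul_le_mul_left _ hm
  calc (2 : ℝ) ^ (l + m) * charValue A (2 ^ (l + m)) ≤ 2 ^ (l + m) * (C * s ^ l) := by gcongr
    _ = 2 ^ m * C * (2 * s) ^ l := by rw [pow_add, mul_pow]; ring

theorem IsWeakSchatten.dyadicApprox {p : ℝ} {T : K →L[ℂ] K} (h : IsWeakSchatten p T) :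
    ∃ C, DyadicApprox 1 C ((2 : ℝ) ^ (-1 / p)) T := by
  obtain ⟨C, hC⟩ := h
  set s : ℝ := (2 : ℝ) ^ (-1 / p) with hs
  have hs0 : 0 < s := by positivity
  -- The index `2ˡ - 1` turns `(k + 1)^{-1/p}` into exactly `sˡ`. The constant `|C| + 1` makes the
  -- inequality strict, since the infimum defining `charValue` need not be known to be attained.
  have hbound : ∀ l, charValue T (2 ^ l - 1) < (|C| + 1) * s ^ l := fun l => by
    refine (hC _).trans_lt ?_
    have h1 : (((2 ^ l - 1 : ℕ) : ℝ) + 1) = 2 ^ l := by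
      rw [Nat.cast_sub Nat.one_le_two_pow]
      push_cast
      ring
    rw [h1, hs, ← Real.rpow_natCast, ← Real.rpow_natCast, ← Real.rpow_mul (by norm_num),
      ← Real.rpow_mul (by norm_num), mul_comm (l : ℝ)]
    exact mul_lt_mul_of_pos_right (by linarith [le_abs_self C]) (by positivity)
  have hex : ∀ l, ∃ F : K →L[ℂ] K, (F : K →ₗ[ℂ] K).rank ≤ ((1 * 2 ^ l : ℕ) : Cardinal.{u}) ∧
      ‖T - F‖ ≤ (|C| + 1) * s ^ l := fun l => by
    obtain ⟨r, ⟨F, h1, h2, rfl⟩, h3⟩ := exists_lt_of_csInf_lt (charValue_set_nonempty _ _) (hbound l)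
    refine ⟨F, ?_, h3.le⟩
    rw [LinearMap.rank, ← Module.finrank_eq_rank]
    exact_mod_cast h2.trans (by omega)
  choose F hF1 hF2 using hex
  -- The summand `‖T‖` pays for the prescribed value `W 0 = 0`.
  refine ⟨|C| + 1 + ‖T‖, fun l => if l = 0 then 0 else F l, by simp, fun l => ?_, fun l => ?_⟩
  · dsimp only
    split_ifs
    · simp [LinearMap.rank_zero]
    · exact hF1 l
  · dsimp only
    split_ifs with h0
    · simp only [h0, sub_zero, pow_zero, mul_one]
      linarith [abs_nonneg C]
    · refine (hF2 l).trans ?_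
      have := norm_nonneg T
      exact mul_le_mul_of_nonneg_right (by linarith) (by positivity)

end DyadicApprox

/-! ### Rotating and contracting tuples -/

section Tuples

variable {α : Type*}

open Fin.CommRing in
theorem Fin.val_nsmul_one {n : ℕ} (j : Fin (n + 1)) : (j : ℕ) • (1 : Fin (n + 1)) = j := by
  rw [nsmul_one, Fin.cast_val_eq_self]

theorem snoc_comp_finRotate_symm {n : ℕ} (w : Fin n → α) (x : α) :
    (fun i => (Fin.snoc w x : Fin (n + 1) → α) ((finRotate (n + 1)).symm i)) =
      (Fin.cons x w : Fin (n + 1) → α) := by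
  funext i
  refine Fin.cases ?_ (fun j => ?_) i
  · have : (finRotate (n + 1)).symm 0 = Fin.last n := by
      rw [Equiv.symm_apply_eq, finRotate_last]
    simp [this]
  · have : (finRotate (n + 1)).symm j.succ = j.castSucc := by
      rw [Equiv.symm_apply_eq, finRotate_apply, Fin.coeSucc_eq_succ]
    simp [this]

theorem contractNth_zero_cons_cons {n : ℕ} (op : α → α → α) (x y : α) (w : Fin n → α) :
    Fin.contractNth (0 : Fin (n + 2)) op (Fin.cons x (Fin.cons y w) : Fin (n + 2) → α) =
      (Fin.cons (op x y) w : Fin (n + 1) → α) := by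
  funext i
  refine Fin.cases ?_ (fun j => ?_) i <;> simp [Fin.contractNth]

theorem contractNth_succ_cons {n : ℕ} (op : α → α → α) (i : Fin (n + 1)) (x : α)
    (w : Fin (n + 1) → α) :
    Fin.contractNth i.succ op (Fin.cons x w : Fin (n + 2) → α) =
      (Fin.cons x (Fin.contractNth i op w) : Fin (n + 1) → α) := by
  funext j
  refine Fin.cases ?_ (fun j => ?_) j <;> simp [Fin.contractNth]

theorem contractNth_last_snoc_snoc {n : ℕ} (op : α → α → α) (x y : α) (w : Fin n → α) :
    Fin.contractNth (Fin.last n).castSucc op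
      (Fin.snoc (Fin.snoc w x : Fin (n + 1) → α) y : Fin (n + 2) → α) =
      (Fin.snoc w (op x y) : Fin (n + 1) → α) := by
  funext i
  refine Fin.lastCases ?_ (fun j => ?_) i
  · simp [Fin.contractNth, Fin.succ_last]
  · simp [Fin.contractNth]

theorem contractNth_castSucc_snoc {n : ℕ} (op : α → α → α) (i : Fin n) (y : α)
    (w : Fin (n + 1) → α) :
    Fin.contractNth i.castSucc.castSucc op (Fin.snoc w y : Fin (n + 2) → α) =
      (Fin.snoc (Fin.contractNth i.castSucc op w) y : Fin (n + 1) → α) := by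
  funext j
  refine Fin.lastCases ?_ (fun j => ?_) j
  · have h : ¬ n < (i : ℕ) := by omega
    have h' : ¬ n = (i : ℕ) := by omega
    simp [Fin.contractNth, h, h', Fin.succ_last]
  · simp [Fin.contractNth, ← Fin.castSucc_succ]

end Tuples

/-! ### Cyclic cochains and Lie derivatives -/

section Cyclic

variable {B : Type*} [NonUnitalRing B] [Module ℂ B]

theorem cyclicOp_apply (n : ℕ) (φ : Cochain B n) (v : Fin (n + 1) → B) :
    cyclicOp B n φ v = (-1) ^ n * φ fun i => v ((finRotate (n + 1)).symm i) := rfl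

theorem cyclicOp_pow_apply (n j : ℕ) (φ : Cochain B n) (v : Fin (n + 1) → B) :
    (cyclicOp B n ^ j) φ v = ((-1) ^ n) ^ j * φ fun i => v (i - j • (1 : Fin (n + 1))) := by
  induction j generalizing φ v with
  | zero => simp
  | succ j ih =>
    rw [pow_succ, Module.End.mul_apply, ih, cyclicOp_apply, pow_succ, mul_assoc]
    congr 3
    funext i
    rw [finRotate_symm_apply, succ_nsmul, sub_sub, add_comm (1 : Fin (n + 1))]

theorem apply_cons_eq_apply_snoc {n : ℕ} {φ : Cochain B n} (hn : Even n)
    (hφ : cyclicOp B n φ = φ) (w : Fin n → B) (x : B) :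
    φ (Fin.cons x w : Fin (n + 1) → B) = φ (Fin.snoc w x : Fin (n + 1) → B) := by
  conv_rhs => rw [← hφ]
  rw [cyclicOp_apply, snoc_comp_finRotate_symm, hn.neg_one_pow, one_mul]

/-- Apply `δ` to the last argument. -/
def insertLast (δ : B →ₗ[ℂ] B) {n : ℕ} (φ : Cochain B n) : Cochain B n :=
  φ.compLinearMap (Function.update (fun _ => LinearMap.id) (Fin.last n) δ)

theorem insertLast_apply (δ : B →ₗ[ℂ] B) {n : ℕ} (φ : Cochain B n) (v : Fin (n + 1) → B) :
    insertLast δ φ v = φ (Function.update v (Fin.last n) (δ (v (Fin.last n)))) := by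
  rw [insertLast, MultilinearMap.compLinearMap_apply]
  congr 1
  funext i
  by_cases h : i = Fin.last n
  · subst h; simp
  · simp [h]

theorem insertLast_snoc (δ : B →ₗ[ℂ] B) {n : ℕ} (φ : Cochain B n) (w : Fin n → B) (x : B) :
    insertLast δ φ (Fin.snoc w x : Fin (n + 1) → B) = φ (Fin.snoc w (δ x) : Fin (n + 1) → B) := by
  rw [insertLast_apply, Fin.update_snoc_last, Fin.snoc_last]

/-- The Lie derivative `∑ᵢ φ(a₀, …, δ aᵢ, …, aₙ)`. -/
def lieDeriv (δ : B →ₗ[ℂ] B) {n : ℕ} (φ : Cochain B n) : Cochain B n :=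
  ∑ i, φ.compLinearMap (Function.update (fun _ => LinearMap.id) i δ)

theorem lieDeriv_apply (δ : B →ₗ[ℂ] B) {n : ℕ} (φ : Cochain B n) (v : Fin (n + 1) → B) :
    lieDeriv δ φ v = ∑ i, φ (Function.update v i (δ (v i))) := by
  rw [lieDeriv, _root_.sum_apply]
  refine Finset.sum_congr rfl fun k _ => ?_
  rw [MultilinearMap.compLinearMap_apply]
  congr 1
  funext i
  by_cases h : i = k
  · subst h; simp
  · simp [h]

/-- For a cyclic `φ` of even degree the powers of `λ` do not change `φ`; they only carry `δ` from
the last slot to each of the others, once each. -/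
theorem normOp_insertLast {n : ℕ} {φ : Cochain B n} (hn : Even n) (hφ : cyclicOp B n φ = φ) (δ : B →ₗ[ℂ] B) :
    normOp B n (insertLast δ φ) = lieDeriv δ φ := by
  have hrot : ∀ (j : ℕ) (v : Fin (n + 1) → B), φ (fun i => v (i - j • (1 : Fin (n + 1)))) = φ v := by
    intro j v
    have h : (cyclicOp B n ^ j) φ = φ := by
      induction j with
      | zero => rfl
      | succ j ih => rw [pow_succ, Module.End.mul_apply, hφ, ih]
    conv_rhs => rw [← h]
    rw [cyclicOp_pow_apply, hn.neg_one_pow, one_pow, one_mul]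
  ext v
  -- The term `λʲ` applies `δ` to the entry of index `last - j`, hence the reindexing by
  -- `Equiv.subLeft`.
  rw [normOp, LinearMap.sum_apply, _root_.sum_apply, lieDeriv_apply,
    ← Equiv.sum_comp (Equiv.subLeft (Fin.last n)), Finset.sum_range]
  refine Finset.sum_congr rfl fun j _ => ?_
  rw [cyclicOp_pow_apply, hn.neg_one_pow, one_pow, one_mul, insertLast_apply, Fin.val_nsmul_one,
    Equiv.subLeft_apply, ← hrot j (Function.update v _ _)]
  congr 1
  funext i
  simp only [Function.update_apply, Fin.val_nsmul_one, sub_left_inj]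

variable [IsScalarTower ℂ B B] [SMulCommClass ℂ B B]

theorem barDiff_apply (n : ℕ) (φ : Cochain B n) (v : Fin (n + 2) → B) :
    barDiff B n φ v =
      ∑ i : Fin (n + 1), (-1) ^ (i : ℕ) * φ (Fin.contractNth i.castSucc (· * ·) v) := by
  simp [barDiff, face_apply]

theorem hochschildDiff_apply (n : ℕ) (φ : Cochain B n) (v : Fin (n + 2) → B) :
    hochschildDiff B n φ v =
      ∑ i : Fin (n + 1), (-1) ^ (i : ℕ) * φ (Fin.contractNth i.castSucc (· * ·) v) +
        (-1) ^ (n + 1) * φ (Fin.contractNth (0 : Fin (n + 2)) (· * ·)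
          fun i => v ((finRotate (n + 2)).symm i)) := by
  rw [hochschildDiff, LinearMap.add_apply, _root_.add_apply, barDiff_apply]
  rfl

theorem mem_cyclicCocycles_iff {n : ℕ} {φ : Cochain B n} :
    φ ∈ cyclicCocycles B n ↔ cyclicOp B n φ = φ ∧ hochschildDiff B n φ = 0 := by
  rw [cyclicCocycles, Submodule.mem_inf, LinearMap.mem_ker, LinearMap.mem_ker, LinearMap.sub_apply,
    Module.End.one_apply, sub_eq_zero, eq_comm (a := φ)]

/-! ### The Cartan homotopy formula -/

/-- The cochain `(a₀, …, aₙ₊₁) ↦ φ(δ(aₙ₊₁) a₀, a₁, …, aₙ)`. -/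
def contractDeriv (δ : B →ₗ[ℂ] B) {n : ℕ} (φ : Cochain B n) : Cochain B (n + 1) :=
  insertLast δ (rotate B (n + 1) (face B n 0 φ))

theorem contractDeriv_snoc_cons (δ : B →ₗ[ℂ] B) {n : ℕ} (φ : Cochain B n) (u : Fin n → B)
    (x y : B) :
    contractDeriv δ φ (Fin.snoc (Fin.cons x u : Fin (n + 1) → B) y : Fin (n + 2) → B) =
      φ (Fin.cons (δ y * x) u : Fin (n + 1) → B) := by
  rw [contractDeriv, insertLast_snoc, rotate_apply, snoc_comp_finRotate_symm, face_apply]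
  exact congrArg φ (contractNth_zero_cons_cons _ _ _ _)

section Cocycle

variable {n : ℕ} {φ : Cochain B n}

theorem sum_apply_contractNth_of_hochschildDiff_eq_zero (hn : Even n)
    (hb : hochschildDiff B n φ = 0) (u : Fin n → B) (x y : B) :
    ∑ i : Fin (n + 1), (-1) ^ (i : ℕ) * φ (Fin.contractNth i.castSucc (· * ·)
      (Fin.snoc (Fin.cons x u : Fin (n + 1) → B) y : Fin (n + 2) → B)) =
      φ (Fin.cons (y * x) u : Fin (n + 1) → B) := by
  have h := hochschildDiff_apply n φ (Fin.snoc (Fin.cons x u : Fin (n + 1) → B) y : Fin (n + 2) → B)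
  rw [hb, snoc_comp_finRotate_symm, contractNth_zero_cons_cons, hn.add_one.neg_one_pow,
    _root_.zero_apply] at h
  linear_combination -h

theorem exists_eq_cons {α : Type*} {k : ℕ} (w : Fin (k + 1) → α) :
    ∃ (x : α) (u : Fin k → α), w = (Fin.cons x u : Fin (k + 1) → α) :=
  ⟨w 0, Fin.tail w, (Fin.cons_self_tail w).symm⟩

theorem exists_eq_snoc {α : Type*} {k : ℕ} (w : Fin (k + 1) → α) :
    ∃ (u : Fin k → α) (x : α), w = (Fin.snoc u x : Fin (k + 1) → α) :=
  ⟨Fin.init w, w (Fin.last k), (Fin.snoc_init_self w).symm⟩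

/-- In `b'` only the last face meets `δ` on a product, as `δ(yz) = δ(y) z + y δ(z)`. The terms with
`δ(z)` add up to `b'φ` at last entry `δ(z)`, which `bφ = 0` turns into `φ(δ(z) x, …)`. The term with
`δ(y) z` is rotated to the front by cyclicity. In odd degree `n + 1` these two are the terms of `1 -
λ`. -/
theorem one_sub_cyclicOp_contractDeriv (hn : Even n) (hφ : cyclicOp B n φ = φ)
    (hb : hochschildDiff B n φ = 0) (δ : B →ₗ[ℂ] B) (hδ : ∀ a b, δ (a * b) = δ a * b + a * δ b) :
    (1 - cyclicOp B (n + 1)) (contractDeriv δ φ) = barDiff B n (insertLast δ φ) := by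
  ext v
  obtain ⟨w, z, rfl⟩ := exists_eq_snoc v
  obtain ⟨x, u, hw⟩ := exists_eq_cons w
  obtain ⟨u', y, hw'⟩ := exists_eq_snoc w
  have h1 : ∀ i : Fin n, insertLast δ φ (Fin.contractNth i.castSucc.castSucc (· * ·)
      (Fin.snoc w z : Fin (n + 2) → B)) = φ (Fin.contractNth i.castSucc.castSucc (· * ·)
      (Fin.snoc w (δ z) : Fin (n + 2) → B)) := fun i => by
    rw [contractNth_castSucc_snoc, insertLast_snoc, contractNth_castSucc_snoc]
  have h2 := sum_apply_contractNth_of_hochschildDiff_eq_zero hn hb u x (δ z)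
  rw [← hw, Fin.sum_univ_castSucc] at h2
  have h3 : insertLast δ φ (Fin.contractNth (Fin.last n).castSucc (· * ·)
      (Fin.snoc w z : Fin (n + 2) → B)) = φ (Fin.cons (δ y * z) u' : Fin (n + 1) → B)
      + φ (Fin.contractNth (Fin.last n).castSucc (· * ·) (Fin.snoc w (δ z) : Fin (n + 2) → B)) := by
    rw [hw', contractNth_last_snoc_snoc, contractNth_last_snoc_snoc, insertLast_snoc, hδ,
      apply_cons_eq_apply_snoc hn hφ]
    have := φ.map_update_add (Fin.snoc u' 0 : Fin (n + 1) → B) (Fin.last n) (δ y * z) (y * δ z)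
    simpa only [Fin.update_snoc_last] using this
  have h4 : contractDeriv δ φ (Fin.snoc w z : Fin (n + 2) → B) =
      φ (Fin.cons (δ z * x) u : Fin (n + 1) → B) := by rw [hw, contractDeriv_snoc_cons]
  have h5 : contractDeriv δ φ (Fin.cons z w : Fin (n + 2) → B) =
      φ (Fin.cons (δ y * z) u' : Fin (n + 1) → B) := by
    rw [hw', Fin.cons_snoc_eq_snoc_cons, contractDeriv_snoc_cons]
  rw [LinearMap.sub_apply, _root_.sub_apply, Module.End.one_apply, cyclicOp_apply,
    snoc_comp_finRotate_symm, barDiff_apply, Fin.sum_univ_castSucc, h3, h4, h5,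
    hn.add_one.neg_one_pow]
  simp only [h1]
  simp only [Fin.val_castSucc, Fin.val_last, hn.neg_one_pow] at h2 ⊢
  linear_combination -h2

/-- By the Leibniz rule the face multiplying the last two entries `y`, `z` splits in two. The part
with `δ(y)` cancels the wrap-around face, and what is left is `bφ` evaluated at `(δ(z) x, u, y)`. -/
theorem hochschildDiff_contractDeriv (hn : Even n)
    (hb : hochschildDiff B n φ = 0) (δ : B →ₗ[ℂ] B) (hδ : ∀ a b, δ (a * b) = δ a * b + a * δ b) :
    hochschildDiff B (n + 1) (contractDeriv δ φ) = 0 := by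
  ext v
  obtain ⟨w, z, rfl⟩ := exists_eq_snoc v
  obtain ⟨w', y, rfl⟩ := exists_eq_snoc w
  obtain ⟨x, u, rfl⟩ := exists_eq_cons w'
  have h1 : ∀ i : Fin (n + 1), contractDeriv δ φ (Fin.contractNth i.castSucc.castSucc (· * ·)
      (Fin.snoc (Fin.snoc (Fin.cons x u : Fin (n + 1) → B) y : Fin (n + 2) → B) z : Fin (n + 3) → B))
      = φ (Fin.contractNth i.castSucc (· * ·)
        (Fin.snoc (Fin.cons (δ z * x) u : Fin (n + 1) → B) y : Fin (n + 2) → B)) := fun i => by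
    rw [contractNth_castSucc_snoc, ← Fin.cons_snoc_eq_snoc_cons, ← Fin.cons_snoc_eq_snoc_cons]
    refine Fin.cases ?_ (fun j => ?_) i
    · obtain ⟨p, q, hpq⟩ := exists_eq_cons (Fin.snoc u y : Fin (n + 1) → B)
      rw [hpq, Fin.castSucc_zero, contractNth_zero_cons_cons, contractNth_zero_cons_cons,
        contractDeriv_snoc_cons, mul_assoc]
    · rw [Fin.castSucc_succ, contractNth_succ_cons, contractNth_succ_cons, contractDeriv_snoc_cons]
  have h2 := sum_apply_contractNth_of_hochschildDiff_eq_zero hn hb u (δ z * x) y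
  have h3 : φ (Fin.cons (δ (y * z) * x) u : Fin (n + 1) → B) =
      φ (Fin.cons (δ y * (z * x)) u : Fin (n + 1) → B) +
      φ (Fin.cons (y * (δ z * x)) u : Fin (n + 1) → B) := by
    rw [hδ, add_mul, mul_assoc, mul_assoc]
    have := φ.map_update_add (Fin.cons 0 u : Fin (n + 1) → B) 0 (δ y * (z * x)) (y * (δ z * x))
    simpa only [Fin.update_cons_zero] using this
  rw [hochschildDiff_apply, snoc_comp_finRotate_symm, Fin.sum_univ_castSucc,
    contractNth_last_snoc_snoc, contractDeriv_snoc_cons, ← Fin.cons_snoc_eq_snoc_cons,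
    contractNth_zero_cons_cons, Fin.cons_snoc_eq_snoc_cons, Fin.cons_snoc_eq_snoc_cons,
    contractDeriv_snoc_cons, h3]
  simp only [h1]
  simp only [Fin.val_castSucc, Fin.val_last, hn.add_one.neg_one_pow, pow_succ _ (n + 1),
    _root_.zero_apply] at h2 ⊢
  linear_combination h2

/-- The primitive has two components. `contractDeriv δ φ` has odd degree and sits in an even column,
with differential `b'(insertLast δ φ)`; `insertLast δ φ` sits in an odd column, with differential
`-b'(insertLast δ φ) + N(insertLast δ φ)`. The sum is `N(insertLast δ φ)`, the Lie derivative. -/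
theorem of_lieDeriv_mem_range (hn : Even n) (hφ : φ ∈ cyclicCocycles B n)
    (δ : B →ₗ[ℂ] B) (hδ : ∀ a b, δ (a * b) = δ a * b + a * δ b) :
    TotalCochain.of B n (lieDeriv δ φ) ∈ LinearMap.range (totalDiff B (0 - 1)) := by
  obtain ⟨h1, h2⟩ := mem_cyclicCocycles_iff.1 hφ
  refine ⟨TotalCochain.of B (n + 1) (contractDeriv δ φ) + TotalCochain.of B n (insertLast δ φ), ?_⟩
  have e0 : (n : ZMod 2) = 0 := (ZMod.natCast_eq_zero_iff_even).2 hn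
  have e1 : ((n + 1 : ℕ) : ZMod 2) = 0 - 1 := by rw [Nat.cast_succ, e0]; decide
  have e2 : (n : ZMod 2) ≠ 0 - 1 := by rw [e0]; decide
  rw [map_add, totalDiff_of_even _ _ _ e1, totalDiff_of_odd _ _ _ e2,
    one_sub_cyclicOp_contractDeriv hn h1 h2 δ hδ, hochschildDiff_contractDeriv hn h2 δ hδ,
    normOp_insertLast hn h1, map_zero]
  abel

end Cocycle

end Cyclic

/-! ### The cyclic cocycle of a difference of two homomorphisms -/

section TraceForm

section Prod

variable {E : Type*} [Ring E]

theorem prod_ofFn_update_zero {k : ℕ} (G : Fin (k + 1) → E) (y : E) :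
    (List.ofFn (Function.update G 0 y)).prod = y * (List.ofFn fun i => G (Fin.succ i)).prod := by
  simp [List.ofFn_succ]

theorem prod_ofFn_update_succ {k : ℕ} (G : Fin (k + 1) → E) (i : Fin k) (y : E) :
    (List.ofFn (Function.update G i.succ y)).prod =
      G 0 * (List.ofFn (Function.update (fun j => G (Fin.succ j)) i y)).prod := by
  rw [List.ofFn_succ, List.prod_cons, Function.update_of_ne (Fin.succ_ne_zero i).symm]
  congr 3
  funext j
  simp [Function.update_apply]

theorem prod_ofFn_update_last {k : ℕ} (G : Fin (k + 1) → E) (y : E) :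
    (List.ofFn (Function.update G (Fin.last k) y)).prod =
      (List.ofFn fun i : Fin k => G i.castSucc).prod * y := by
  rw [List.ofFn_succ']
  simp [Fin.castSucc_ne_last]

end Prod

variable {B : Type*} [NonUnitalRing B] [Module ℂ B] {E : Type*} [Ring E] [Algebra ℂ E]

/-- The cochain `(a₀, …, aₙ) ↦ t (F(a₀) ⋯ F(aₙ))`. -/
def traceForm (t : E →ₗ[ℂ] ℂ) (F : B →ₗ[ℂ] E) (n : ℕ) : Cochain B n :=
  t.compMultilinearMap ((MultilinearMap.mkPiAlgebraFin ℂ (n + 1) E).compLinearMap fun _ => F)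

theorem traceForm_apply (t : E →ₗ[ℂ] ℂ) (F : B →ₗ[ℂ] E) (n : ℕ) (v : Fin (n + 1) → B) :
    traceForm t F n v = t (List.ofFn fun i => F (v i)).prod := by
  simp [traceForm]

variable {π F : B →ₗ[ℂ] E} (hF : ∀ a b, F (a * b) = π a * F b + F a * (π b - F b))

include hF in
theorem prod_ofFn_contractNth {n : ℕ} (i : Fin (n + 1)) (v : Fin (n + 2) → B) :
    (List.ofFn fun j => F (Fin.contractNth i.castSucc (· * ·) v j)).prod =
      (List.ofFn (Function.update (fun j => F (v j)) i.castSucc (π (v i.castSucc)))).prod +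
      (List.ofFn (Function.update (fun j => F (v j)) i.succ (π (v i.succ) - F (v i.succ)))).prod := by
  induction n with
  | zero =>
    obtain ⟨x, w, rfl⟩ := exists_eq_cons v
    obtain ⟨y, u, rfl⟩ := exists_eq_cons w
    obtain rfl : i = 0 := Fin.fin_one_eq_zero i
    rw [Fin.castSucc_zero, contractNth_zero_cons_cons, prod_ofFn_update_zero, prod_ofFn_update_succ,
      List.ofFn_succ]
    simp [hF]
  | succ n ih =>
    obtain ⟨x, w, rfl⟩ := exists_eq_cons v
    refine Fin.cases ?_ (fun j => ?_) i
    · obtain ⟨y, u, rfl⟩ := exists_eq_cons w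
      rw [Fin.castSucc_zero, contractNth_zero_cons_cons, prod_ofFn_update_zero,
        prod_ofFn_update_succ, prod_ofFn_update_zero, List.ofFn_succ]
      simp only [Fin.cons_zero, Fin.cons_succ, List.prod_cons, hF, List.ofFn_succ (n := n + 1)]
      noncomm_ring
    · rw [Fin.castSucc_succ, contractNth_succ_cons, prod_ofFn_update_succ, prod_ofFn_update_succ,
        List.ofFn_succ]
      simp only [Fin.cons_zero, Fin.cons_succ, List.prod_cons, ih, mul_add]

variable [IsScalarTower ℂ B B] [SMulCommClass ℂ B B] {t : E →ₗ[ℂ] ℂ} {n : ℕ}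

include hF in
/-- The character of a pair of homomorphisms `π`, `π - F` is a cyclic cocycle, if `t` is a trace on
the relevant products. -/
theorem traceForm_mem_cyclicCocycles (hn : Even n)
    (h₁ : ∀ (x : B) (a : Fin n → B), t (F x * (List.ofFn fun i => F (a i)).prod) =
      t ((List.ofFn fun i => F (a i)).prod * F x))
    (h₂ : ∀ (x : B) (a : Fin (n + 1) → B), t (π x * (List.ofFn fun i => F (a i)).prod) =
      t ((List.ofFn fun i => F (a i)).prod * π x))
    (h₃ : ∀ (x y : B) (a : Fin n → B),
      t (F x * ((π y - F y) * (List.ofFn fun i => F (a i)).prod)) =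
        t ((π y - F y) * (List.ofFn fun i => F (a i)).prod * F x)) :
    traceForm t F n ∈ cyclicCocycles B n := by
  refine mem_cyclicCocycles_iff.2 ⟨?_, ?_⟩
  · ext v
    obtain ⟨w, x, rfl⟩ := exists_eq_snoc v
    rw [cyclicOp_apply, snoc_comp_finRotate_symm, hn.neg_one_pow, one_mul, traceForm_apply,
      traceForm_apply, List.ofFn_succ, List.prod_cons, List.ofFn_succ', List.concat_eq_append,
      List.prod_append, List.prod_singleton]
    simpa using h₁ x w
  · ext v
    obtain ⟨w, z, rfl⟩ := exists_eq_snoc v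
    obtain ⟨x, u, hw⟩ := exists_eq_cons w
    set v : Fin (n + 2) → B := Fin.snoc w z with hv
    have hv0 : v 0 = x := by rw [hv, hw, ← Fin.cons_snoc_eq_snoc_cons, Fin.cons_zero]
    have hvl : v (Fin.last _) = z := by rw [hv, Fin.snoc_last]
    have hvs : ∀ i, v (Fin.castSucc i) = w i := fun i => by rw [hv, Fin.snoc_castSucc]
    have hw' : ∀ i, v (Fin.succ i) = (Fin.snoc u z : Fin (n + 1) → B) i := fun i => by
      rw [hv, hw, ← Fin.cons_snoc_eq_snoc_cons, Fin.cons_succ]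
    -- `X i` and `Y i` carry `π` and `π - F` in slot `i`, so `X i - Y i` is independent of `i`. The
    -- faces are `X i + Y (i+1)` and the wrap-around face is `X (n+1) + Y 0`. The coboundary is thus
    -- the alternating sum of the `n + 2` equal numbers `X i - Y i`, which vanishes for even `n`.
    set X : Fin (n + 2) → ℂ := fun i =>
      t (List.ofFn (Function.update (fun j => F (v j)) i (π (v i)))).prod with hX
    set Y : Fin (n + 2) → ℂ := fun i =>
      t (List.ofFn (Function.update (fun j => F (v j)) i (π (v i) - F (v i)))).prod with hY
    have hXY : ∀ i, X i - Y i = t (List.ofFn fun j => F (v j)).prod := fun i => by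
      have h := (MultilinearMap.mkPiAlgebraFin ℂ (n + 2) E).map_update_sub (fun j => F (v j)) i
        (π (v i)) (F (v i))
      simp only [MultilinearMap.mkPiAlgebraFin_apply] at h
      rw [hX, hY]
      simp only [h, map_sub, sub_sub_cancel]
      rw [Function.update_eq_self i fun j => F (v j)]
    have hface : ∀ i : Fin (n + 1), traceForm t F n (Fin.contractNth i.castSucc (· * ·) v) =
        X i.castSucc + Y i.succ := fun i => by
      rw [traceForm_apply, prod_ofFn_contractNth hF, map_add]
    have hrot : traceForm t F n (Fin.cons (z * x) u : Fin (n + 1) → B) = X (Fin.last _) + Y 0 := by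
      rw [traceForm_apply, List.ofFn_succ, List.prod_cons]
      simp only [Fin.cons_zero, Fin.cons_succ, hF, add_mul, map_add]
      congr 1
      · have := h₂ z w
        rw [hX]
        simp only [prod_ofFn_update_last, hvs, hvl, ← this]
        simp [hw, List.ofFn_succ, mul_assoc]
      · rw [mul_assoc, h₃, hY]
        simp only [prod_ofFn_update_zero, hw', hv0]
        rw [List.ofFn_succ', List.concat_eq_append, List.prod_append, List.prod_singleton]
        simp [mul_assoc]
    rw [hochschildDiff_apply, hv, snoc_comp_finRotate_symm, ← hv, hw, contractNth_zero_cons_cons,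
      hrot, hn.add_one.neg_one_pow]
    simp only [hface, mul_add, Finset.sum_add_distrib, _root_.zero_apply]
    have e1 := Fin.sum_univ_castSucc fun i : Fin (n + 2) => (-1 : ℂ) ^ (i : ℕ) * X i
    have e2 := Fin.sum_univ_succ fun i : Fin (n + 2) => (-1 : ℂ) ^ (i : ℕ) * Y i
    have e3 : ∑ i : Fin (n + 2), (-1 : ℂ) ^ (i : ℕ) * X i -
        ∑ i : Fin (n + 2), (-1 : ℂ) ^ (i : ℕ) * Y i = 0 := by
      rw [← Finset.sum_sub_distrib]
      simp only [← mul_sub, hXY, ← Finset.sum_mul]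
      rw [Fin.sum_univ_eq_sum_range (fun i => (-1 : ℂ) ^ i), neg_one_geom_sum,
        if_pos (by simpa [Nat.even_add] using hn), zero_mul]
    simp only [Fin.val_castSucc, Fin.val_last, Fin.val_succ, Fin.val_zero, pow_succ,
      hn.neg_one_pow, pow_zero, mul_neg, mul_one, neg_mul, one_mul,
      Finset.sum_neg_distrib] at e1 e2 e3 ⊢
    linear_combination e3 + e2 - e1

end TraceForm

/-! ### Homotopy invariance along a flow -/

section Pullback

variable {B : Type*} [NonUnitalRing B] [Module ℂ B] [IsScalarTower ℂ B B] [SMulCommClass ℂ B B]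
  {n : ℕ} {φ : Cochain B n}

theorem compLinearMap_mem_cyclicCocycles (hφ : φ ∈ cyclicCocycles B n) {τ : B →ₗ[ℂ] B}
    (hτ : ∀ a b, τ (a * b) = τ a * τ b) :
    φ.compLinearMap (fun _ => τ) ∈ cyclicCocycles B n := by
  obtain ⟨h1, h2⟩ := mem_cyclicCocycles_iff.1 hφ
  refine mem_cyclicCocycles_iff.2 ⟨?_, ?_⟩
  · ext v
    exact congrArg (fun ψ : Cochain B n => ψ fun i => τ (v i)) h1
  · ext v
    have h := congrArg (fun ψ : Cochain B (n + 1) => ψ fun i => τ (v i)) h2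
    have hc : ∀ (k : Fin (n + 2)) (v : Fin (n + 2) → B), (fun i => τ (Fin.contractNth k (· * ·) v i)) =
        Fin.contractNth k (· * ·) fun i => τ (v i) := fun k v =>
      Fin.comp_contractNth (· * ·) (· * ·) hτ k v
    simp only [hochschildDiff_apply, MultilinearMap.compLinearMap_apply, hc] at h ⊢
    exact h

/-- Cyclic cocycles that are joined by a flow, generated by a derivation, of multiplicative maps
define the same class. -/
theorem of_compLinearMap_sub_mem_range (hn : Even n) (hφ : φ ∈ cyclicCocycles B n)
    (τ : ℝ → B →ₗ[ℂ] B) (hτ : ∀ s a b, τ s (a * b) = τ s a * τ s b)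
    (δ : B →ₗ[ℂ] B) (hδ : ∀ a b, δ (a * b) = δ a * b + a * δ b)
    (hderiv : ∀ (v : Fin (n + 1) → B) (s : ℝ), HasDerivAt (fun s => φ fun i => τ s (v i))
      (∑ i, φ fun j => τ s (Function.update v i (δ (v i)) j)) s) :
    TotalCochain.of B n (φ.compLinearMap (fun _ => τ 1) - φ.compLinearMap (fun _ => τ 0)) ∈
      LinearMap.range (totalDiff B (0 - 1)) := by
  have hcont : ∀ v : Fin (n + 1) → B, Continuous fun s => φ.compLinearMap (fun _ => τ s) v := fun v =>
    continuous_iff_continuousAt.2 fun s => (hderiv v s).continuousAt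
  have hint : ∀ v : Fin (n + 1) → B,
      IntervalIntegrable (fun s => φ.compLinearMap (fun _ => τ s) v) MeasureTheory.volume 0 1 := fun v =>
    (hcont v).intervalIntegrable 0 1
  -- The averaged cocycle `∫₀¹ φ ∘ τ_s ds`. Its Lie derivative is `∫₀¹ (d/ds)(φ ∘ τ_s) ds`, the
  -- difference of the endpoints, so a single application of the Cartan formula suffices.
  let Φ : Cochain B n :=
    { toFun := fun v => ∫ s in (0 : ℝ)..1, φ.compLinearMap (fun _ => τ s) v
      map_update_add' := by
        intro inst v k x y
        rw [← intervalIntegral.integral_add (hint _) (hint _)]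
        refine intervalIntegral.integral_congr fun s _ => ?_
        exact (φ.compLinearMap fun _ => τ s).map_update_add v k x y
      map_update_smul' := by
        intro inst v k c x
        rw [← intervalIntegral.integral_smul]
        refine intervalIntegral.integral_congr fun s _ => ?_
        exact (φ.compLinearMap fun _ => τ s).map_update_smul v k c x }
  have hΦ : ∀ v, Φ v = ∫ s in (0 : ℝ)..1, φ.compLinearMap (fun _ => τ s) v := fun v => rfl
  have hs : ∀ s, φ.compLinearMap (fun _ => τ s) ∈ cyclicCocycles B n := fun s =>
    compLinearMap_mem_cyclicCocycles hφ (hτ s)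
  have hΦc : Φ ∈ cyclicCocycles B n := by
    refine mem_cyclicCocycles_iff.2 ⟨?_, ?_⟩
    · ext v
      rw [cyclicOp_apply, hΦ, hΦ, ← intervalIntegral.integral_const_mul]
      refine intervalIntegral.integral_congr fun s _ => ?_
      have := (mem_cyclicCocycles_iff.1 (hs s)).1
      exact congrArg (fun ψ : Cochain B n => ψ v) this
    · ext v
      rw [hochschildDiff_apply]
      simp only [hΦ, ← intervalIntegral.integral_const_mul]
      rw [← intervalIntegral.integral_finsetSum fun i _ => (hint _).const_mul _,
        ← intervalIntegral.integral_add ?_ ((hint _).const_mul _)]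
      · have : ∀ s, hochschildDiff B n (φ.compLinearMap fun _ => τ s) v = 0 := fun s => by
          rw [(mem_cyclicCocycles_iff.1 (hs s)).2, _root_.zero_apply]
        simp only [hochschildDiff_apply] at this
        simp only [this]
        simp
      · exact (continuous_finsetSum _ fun i _ => (hcont _).const_mul _).intervalIntegrable 0 1
  have hlie : lieDeriv δ Φ = φ.compLinearMap (fun _ => τ 1) - φ.compLinearMap (fun _ => τ 0) := by
    ext v
    rw [lieDeriv_apply]
    simp only [hΦ]
    rw [← intervalIntegral.integral_finsetSum fun i _ => hint _]
    exact intervalIntegral.integral_eq_sub_of_hasDerivAt (fun s _ => hderiv v s)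
      ((continuous_finsetSum _ fun i _ => hcont _).intervalIntegrable 0 1)
  rw [← hlie]
  exact of_lieDeriv_mem_range hn hΦc δ hδ

end Pullback

/-! ### Traces of products with a given dyadic rate -/

section Trace

universe u

variable {K : Type u} [NormedAddCommGroup K] [InnerProductSpace ℂ K]

/-- The trace of nuclear operators extends to a linear functional on all bounded operators. -/
theorem exists_linear_extension_opTrace (K : Type u) [NormedAddCommGroup K]
    [InnerProductSpace ℂ K] [CompleteSpace K] :
    ∃ t : (K →L[ℂ] K) →ₗ[ℂ] ℂ, ∀ (X : K →L[ℂ] K) (c : ℝ), NuclearBound X c → t X = opTrace X := by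
  let N : Submodule ℂ (K →L[ℂ] K) :=
    { carrier := {X | ∃ c, NuclearBound X c}
      add_mem' := fun ⟨c, hc⟩ ⟨d, hd⟩ => ⟨c + d, hc.add hd⟩
      zero_mem' := ⟨0, NuclearBound.zero⟩
      smul_mem' := fun z _ ⟨c, hc⟩ => ⟨_, hc.smul z⟩ }
  let τ : N →ₗ[ℂ] ℂ :=
    { toFun := fun X => opTrace (X : K →L[ℂ] K)
      map_add' := fun ⟨_, _, hc⟩ ⟨_, _, hd⟩ => hc.opTrace_add hd
      map_smul' := fun z X => NuclearBound.opTrace_smul z }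
  -- The extension is purely algebraic. It makes `traceForm` applicable on the whole ring of bounded
  -- operators; its values off the nuclear operators are irrelevant.
  obtain ⟨t, ht⟩ := LinearMap.exists_extend τ
  exact ⟨t, fun X c hX => congrArg (fun f : N →ₗ[ℂ] ℂ => f ⟨X, c, hX⟩) ht⟩

/-- `A` is approximated at the dyadic rate `s`. -/
def HasDyadicRate (s : ℝ) (A : K →L[ℂ] K) : Prop := ∃ M C, DyadicApprox M C s A

namespace HasDyadicRate

variable {s s' : ℝ} {A B : K →L[ℂ] K}

theorem mul (hA : HasDyadicRate s A) (hB : HasDyadicRate s' B) (hs : 0 ≤ s) :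
    HasDyadicRate (s * s') (A * B) := by
  obtain ⟨M, C, hA⟩ := hA
  obtain ⟨M', C', hB⟩ := hB
  exact ⟨_, _, hA.mul hB hs⟩

theorem bounded_mul (A : K →L[ℂ] K) (hB : HasDyadicRate s B) : HasDyadicRate s (A * B) := by
  obtain ⟨M, C, hB⟩ := hB
  exact ⟨_, _, by simpa using (DyadicApprox.of_bounded A).mul hB zero_le_one⟩

theorem mul_bounded (hB : HasDyadicRate s B) (A : K →L[ℂ] K) (hs : 0 ≤ s) :
    HasDyadicRate s (B * A) := by
  obtain ⟨M, C, hB⟩ := hB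
  exact ⟨_, _, by simpa using hB.mul (DyadicApprox.of_bounded A) hs⟩

theorem exists_nuclearBound [CompleteSpace K] (h : HasDyadicRate s A) (hs : 0 ≤ s)
    (hs2 : s < 1 / 2) : ∃ c, NuclearBound A c := by
  obtain ⟨M, C, h⟩ := h
  exact ⟨_, h.nuclearBound hs hs2⟩

theorem opTrace_comm [CompleteSpace K] (hA : HasDyadicRate s A) (hB : HasDyadicRate s' B)
    (hs : 0 ≤ s) (hs1 : s < 1) (hs' : 0 < s') (hss : s * s' < 1 / 2) :
    opTrace (A * B) = opTrace (B * A) := by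
  obtain ⟨M, C, hA⟩ := hA
  obtain ⟨M', C', hB⟩ := hB
  exact hA.opTrace_comm hB hs hs1 hs' hss

end HasDyadicRate

/-- The constant is kept explicit because, being multilinear in the norms `‖S i‖`, it bounds the
trace as a continuous multilinear form in the `S i`. -/
theorem DyadicApprox.prod_ofFn {C s : ℝ} {R : K →L[ℂ] K} (hR : DyadicApprox 1 C s R) (hs : 0 ≤ s)
    {k : ℕ} (S : Fin k → K →L[ℂ] K) :
    DyadicApprox k (∏ i, C * ‖S i‖) (s ^ k) (List.ofFn fun i => R * S i).prod := by
  induction k with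
  | zero => exact ⟨fun _ => 0, rfl, fun l => by simp [LinearMap.rank_zero], fun l => by
      simp only [List.ofFn_zero, List.prod_nil, sub_zero, Finset.univ_eq_empty, Finset.prod_empty,
        pow_zero, one_pow, mul_one]
      exact ContinuousLinearMap.norm_id_le⟩
  | succ k ih =>
    rw [List.ofFn_succ, List.prod_cons, Fin.prod_univ_succ, pow_succ']
    have h := (hR.mul (DyadicApprox.of_bounded (S 0)) hs).mul (ih fun i => S i.succ)
      (by simpa using hs)
    simpa only [mul_one, Nat.add_zero, Nat.add_comm 1 k] using h

theorem star_prod_ofFn {E : Type*} [Monoid E] [StarMul E] {k : ℕ} (f : Fin k → E) :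
    star (List.ofFn f).prod = (List.ofFn fun i => star (f (Fin.rev i))).prod := by
  induction k with
  | zero => simp
  | succ k ih =>
    rw [List.ofFn_succ, List.prod_cons, star_mul, ih, List.ofFn_succ', List.concat_eq_append,
      List.prod_append, List.prod_singleton]
    simp [Fin.rev_castSucc]

theorem Commute.prod_ofFn {E : Type*} [Monoid E] {x : E} {k : ℕ} {f : Fin k → E}
    (h : ∀ i, Commute x (f i)) : Commute x (List.ofFn f).prod := by
  refine Commute.list_prod_right _ _ fun y hy => ?_
  obtain ⟨i, rfl⟩ := List.mem_ofFn.1 hy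
  exact h i

theorem mul_prod_ofFn_mul {E : Type*} [Monoid E] (r : E) {k : ℕ} (f : Fin k → E) :
    r * (List.ofFn fun i => f i * r).prod = (List.ofFn fun i => r * f i).prod * r := by
  induction k with
  | zero => simp
  | succ k ih =>
    rw [List.ofFn_succ, List.ofFn_succ, List.prod_cons, List.prod_cons, mul_assoc (r * f 0), ← ih]
    simp only [mul_assoc]

end Trace

/-! ### The bounded calculus of `D⁻¹` and `d_σ` -/

namespace GradedTwistedTriple

variable {B : Type*} [NonUnitalRing B] [StarRing B] [Module ℂ B] {σ : B ≃ₗ[ℂ] B}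
  {H : Type*} [NormedAddCommGroup H] [InnerProductSpace ℂ H] [CompleteSpace H]
  {T : GradedTwistedTriple σ H} {R : H →L[ℂ] H}

section Inverse

variable (hR : IsBoundedInverse T.D R)

include hR

theorem inverse_mem (ξ : H) : ∃ h : R ξ ∈ T.D.domain, T.D ⟨R ξ, h⟩ = ξ := by
  obtain ⟨h, h'⟩ := hR.1 ξ
  exact ⟨h, by simpa using h'⟩

theorem inverse_apply (x : T.D.domain) : R (T.D x) = x := by
  simpa using hR.2 x

theorem denseRange_inverse : DenseRange R := by
  refine (IsSelfAdjoint.dense_domain T.D_selfAdjoint).mono fun x hx => ?_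
  exact ⟨T.D ⟨x, hx⟩, inverse_apply hR ⟨x, hx⟩⟩

theorem inverse_injective : Function.Injective R := by
  intro x y hxy
  obtain ⟨hx, hx'⟩ := inverse_mem hR x
  obtain ⟨hy, hy'⟩ := inverse_mem hR y
  rw [← hx', ← hy']
  congr 1
  exact Subtype.ext hxy

theorem star_inverse : star R = R := by
  rw [ContinuousLinearMap.star_eq_adjoint, eq_comm, ContinuousLinearMap.eq_adjoint_iff]
  intro x y
  obtain ⟨hx, hx'⟩ := inverse_mem hR x
  obtain ⟨hy, hy'⟩ := inverse_mem hR y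
  have h := LinearPMap.adjoint_isFormalAdjoint (IsSelfAdjoint.dense_domain T.D_selfAdjoint)
  rw [LinearPMap.isSelfAdjoint_def.1 T.D_selfAdjoint] at h
  have := h ⟨R x, hx⟩ ⟨R y, hy⟩
  rw [hx', hy'] at this
  exact this.symm

theorem mul_inverse_cancel {X Y : H →L[ℂ] H} (h : X * R = Y * R) : X = Y := by
  refine ContinuousLinearMap.coeFn_injective
    ((denseRange_inverse hR).equalizer X.continuous Y.continuous ?_)
  exact congrArg (fun Z : H →L[ℂ] H => (Z : H → H)) h

theorem inverse_mul_cancel {X Y : H →L[ℂ] H} (h : R * X = R * Y) : X = Y := by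
  ext x
  exact inverse_injective hR (congrArg (fun Z : H →L[ℂ] H => Z x) h)

/-- `R` is injective with dense range. Identities about the unbounded `D` can therefore be checked
after multiplication by `R` on both sides, where only bounded operators remain. -/
theorem eq_of_inverse_mul_mul_inverse {X Y : H →L[ℂ] H} (h : R * X * R = R * Y * R) : X = Y :=
  inverse_mul_cancel hR (mul_inverse_cancel hR h)

theorem inverse_mul_twistedComm (a : B) :
    R * T.twistedComm a * R = T.π a * R - R * T.π (σ a) := by
  ext ξ
  obtain ⟨hx, hx'⟩ := inverse_mem hR ξ
  obtain ⟨h, h'⟩ := (T.D_bounded a).choose_spec ⟨R ξ, hx⟩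
  rw [hx'] at h'
  have h2 := congrArg R h'
  rw [map_sub, inverse_apply hR] at h2
  exact h2.symm

theorem eq_twistedComm {a : B} {X : H →L[ℂ] H}
    (h : R * X * R = T.π a * R - R * T.π (σ a)) : X = T.twistedComm a :=
  eq_of_inverse_mul_mul_inverse hR (h.trans (inverse_mul_twistedComm hR a).symm)

theorem twistedComm_add (a b : B) :
    T.twistedComm (a + b) = T.twistedComm a + T.twistedComm b := by
  refine (eq_twistedComm hR ?_).symm
  rw [mul_add, add_mul, inverse_mul_twistedComm hR, inverse_mul_twistedComm hR]
  simp only [map_add, add_mul, mul_add]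
  abel

theorem twistedComm_smul (c : ℂ) (a : B) : T.twistedComm (c • a) = c • T.twistedComm a := by
  refine (eq_twistedComm hR ?_).symm
  rw [mul_smul_comm, smul_mul_assoc, inverse_mul_twistedComm hR]
  simp only [map_smul, smul_mul_assoc, mul_smul_comm, smul_sub]

theorem grading_mul_inverse : T.γ * R = -(R * T.γ) := by
  ext ξ
  obtain ⟨hx, hx'⟩ := inverse_mem hR ξ
  obtain ⟨h, h'⟩ := T.γ_anti ⟨R ξ, hx⟩
  rw [hx'] at h'
  have h2 := congrArg R h'
  rw [map_neg, inverse_apply hR] at h2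
  exact h2

theorem grading_mul_twistedComm (a : B) :
    T.γ * T.twistedComm a = -(T.twistedComm a * T.γ) := by
  refine eq_of_inverse_mul_mul_inverse hR ?_
  have h1 : R * (T.γ * T.twistedComm a) * R = -(T.γ * (R * T.twistedComm a * R)) := by
    rw [← mul_assoc, ← neg_eq_iff_eq_neg.2 (grading_mul_inverse hR)]
    noncomm_ring
  have h2 : R * -(T.twistedComm a * T.γ) * R = R * T.twistedComm a * R * T.γ := by
    have := grading_mul_inverse hR
    calc R * -(T.twistedComm a * T.γ) * R = -(R * T.twistedComm a * (T.γ * R)) := by noncomm_ring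
      _ = _ := by rw [this]; noncomm_ring
  rw [h1, h2, inverse_mul_twistedComm hR, mul_sub, ← mul_assoc, ← mul_assoc, T.γ_comm,
    grading_mul_inverse hR, mul_assoc, grading_mul_inverse hR, neg_mul, mul_assoc R, T.γ_comm]
  noncomm_ring

/-- Take the adjoint of `R d_σ(a*) R = a* R - R σ(a*)`: since `σ(a*)* = σ⁻¹(a)`, the right side
becomes `R a - σ⁻¹(a) R`, the negative of the same expression for `σ⁻¹(a)`. -/
theorem star_twistedComm_star (a : B) :
    star (T.twistedComm (star a)) = -T.twistedComm (σ.symm a) := by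
  refine eq_of_inverse_mul_mul_inverse hR ?_
  have h1 := congrArg star (inverse_mul_twistedComm hR (star a))
  rw [star_sub, star_mul, star_mul, star_mul, star_mul, star_inverse hR, T.sigma_star, map_star,
    map_star, star_star, star_star] at h1
  have h2 := inverse_mul_twistedComm hR (σ.symm a)
  rw [LinearEquiv.apply_symm_apply] at h2
  rw [mul_assoc, h1, mul_neg, neg_mul, h2]
  abel

/-- The map `a ↦ d_σ a`, as a linear map. -/
def twistedCommₗ : B →ₗ[ℂ] H →L[ℂ] H where
  toFun := T.twistedComm
  map_add' := twistedComm_add hR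
  map_smul' := twistedComm_smul hR

/-- The map `a ↦ D⁻¹ d_σ a`. -/
def inverseTwistedComm : B →ₗ[ℂ] H →L[ℂ] H := LinearMap.mulLeft ℂ R ∘ₗ twistedCommₗ hR

theorem inverseTwistedComm_apply (a : B) : inverseTwistedComm hR a = R * T.twistedComm a := rfl

/-- The map `b ↦ π b - R d_σ b` stands for the homomorphism `b ↦ D⁻¹ σ(b) D`, because its product
with `R` on the right is `R π(σ b)`. The identity is the product rule for a difference of two
homomorphisms. -/
theorem inverseTwistedComm_mul (a b : B) :
    inverseTwistedComm hR (a * b) = T.π a * inverseTwistedComm hR b +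
      inverseTwistedComm hR a * (T.π b - inverseTwistedComm hR b) := by
  refine mul_inverse_cancel hR ?_
  have ha := inverse_mul_twistedComm hR a
  have hb := inverse_mul_twistedComm hR b
  simp only [inverseTwistedComm_apply]
  rw [inverse_mul_twistedComm hR, add_mul, mul_assoc (T.π a), mul_assoc (R * T.twistedComm a), sub_mul,
    hb, sub_sub_cancel, ← mul_assoc, ha, map_mul, T.sigma_mul, map_mul]
  noncomm_ring

theorem commute_grading_inverseTwistedComm (a : B) :
    Commute T.γ (inverseTwistedComm hR a) := by
  rw [inverseTwistedComm_apply, commute_iff_eq, ← mul_assoc, grading_mul_inverse hR, neg_mul,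
    mul_assoc, grading_mul_twistedComm hR]
  noncomm_ring

end Inverse

/-! ### The two halves -/

variable (T) in
/-- The orthogonal projection onto `H_ε`. -/
def proj (ε : ℤˣ) : H →L[ℂ] H := (T.half ε).subtypeL ∘L (T.half ε).orthogonalProjectionOnto

theorem mem_half_iff {ε : ℤˣ} {x : H} : x ∈ T.half ε ↔ T.γ x = ((ε : ℤ) : ℂ) • x := by
  rw [half, LinearMap.mem_ker, ContinuousLinearMap.coe_coe]
  simp [sub_eq_zero]

theorem sign_mul_self (ε : ℤˣ) : ((ε : ℤ) : ℂ) * ((ε : ℤ) : ℂ) = 1 := by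
  rcases Int.units_eq_one_or ε with rfl | rfl <;> simp

theorem proj_eq (ε : ℤˣ) : T.proj ε = (1 / 2 : ℂ) • (1 + ((ε : ℤ) : ℂ) • T.γ) := by
  have hγ : ∀ x, T.γ (T.γ x) = x := fun x => congrArg (fun Z : H →L[ℂ] H => Z x) T.γ_sq
  ext x
  refine Submodule.eq_starProjection_of_mem_of_inner_eq_zero (K := T.half ε) ?_ ?_
  · rw [mem_half_iff]
    simp only [_root_.smul_apply, _root_.add_apply, one_apply_eq_self, map_smul,
      map_add, hγ, smul_add, smul_smul]
    rw [show ((ε : ℤ) : ℂ) * (1 / 2 * ((ε : ℤ) : ℂ)) = 1 / 2 by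
      linear_combination (1 / 2 : ℂ) * sign_mul_self ε, mul_comm, add_comm]
  · intro w hw
    have h := T.γ_selfAdjoint
    rw [ContinuousLinearMap.isSelfAdjoint_iff'] at h
    have h1 : ⟪T.γ x, w⟫_ℂ = ((ε : ℤ) : ℂ) * ⟪x, w⟫_ℂ := by
      rw [← h, ContinuousLinearMap.adjoint_inner_left, mem_half_iff.1 hw, inner_smul_right]
    simp only [_root_.smul_apply, _root_.add_apply, one_apply_eq_self,
      inner_sub_left, inner_smul_left, inner_add_left, h1]
    simp only [map_div₀, map_one, map_ofNat, map_intCast]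
    linear_combination (-(1 / 2 : ℂ) * ⟪x, w⟫_ℂ) * sign_mul_self ε

theorem commute_proj {X : H →L[ℂ] H} (h : Commute T.γ X) (ε : ℤˣ) : Commute (T.proj ε) X := by
  rw [proj_eq]
  exact (((Commute.one_left X).add_left (h.smul_left _))).smul_left _

theorem proj_mul_of_anticommute {X : H →L[ℂ] H} (h : T.γ * X = -(X * T.γ)) (ε : ℤˣ) :
    T.proj ε * X = X * T.proj (-ε) := by
  rw [proj_eq, proj_eq, smul_mul_assoc, add_mul, smul_mul_assoc, h, mul_smul_comm, mul_add,
    mul_smul_comm]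
  simp

theorem proj_apply_half {ε : ℤˣ} (x : T.half ε) : T.proj ε x = x := by
  simp [proj]

theorem star_proj (ε : ℤˣ) : star (T.proj ε) = T.proj ε := by
  rw [proj_eq, star_smul, star_add, star_smul, star_one, T.γ_selfAdjoint.star_eq]
  simp

/-- Operators commuting with `γ` preserve both eigenspaces, so compression to one of them is
multiplicative. -/
theorem prod_ofFn_block (ε : ℤˣ) {k : ℕ} {f : Fin k → H →L[ℂ] H} (h : ∀ i, Commute T.γ (f i)) :
    (List.ofFn fun i => T.block ε ε (f i)).prod = T.block ε ε (List.ofFn f).prod := by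
  induction k with
  | zero =>
    ext x
    simp [block]
  | succ k ih =>
    rw [List.ofFn_succ, List.ofFn_succ, List.prod_cons, List.prod_cons, ih fun i => h i.succ]
    have hc := commute_proj (Commute.prod_ofFn fun i : Fin k => h i.succ) ε
    ext x
    have h1 := congrArg (fun Z : H →L[ℂ] H => Z x) hc.eq
    simp only [mul_apply_eq_comp] at h1
    rw [proj_apply_half] at h1
    have h2 : T.block ε ε (f 0) (T.block ε ε (List.ofFn fun i => f i.succ).prod x) =
      (T.half ε).orthogonalProjectionOnto (f 0 (T.proj ε ((List.ofFn fun i => f i.succ).prod x))) :=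
      rfl
    rw [mul_apply_eq_comp, h2, h1]
    rfl

section Character

variable (hR : IsBoundedInverse T.D R)

/-- `d_σ a` anticommutes with `γ`, so it maps `H_ε` into `H_{-ε}` and the intermediate projection
acts as the identity. -/
theorem halfForm_eq (ε : ℤˣ) (a : B) :
    T.halfForm R ε a = T.block ε ε (inverseTwistedComm hR a) := by
  ext x
  have h := congrArg (fun Z : H →L[ℂ] H => Z x)
    (proj_mul_of_anticommute (grading_mul_twistedComm hR a) (-ε))
  simp only [mul_apply_eq_comp, neg_neg] at h
  rw [proj_apply_half] at h
  have h2 : T.halfForm R ε a x =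
    (T.half ε).orthogonalProjectionOnto (R (T.proj (-ε) (T.twistedComm a x))) := rfl
  rw [h2, h]
  rfl

theorem halfProduct_eq (ε : ℤˣ) {n : ℕ} (a : Fin (n + 1) → B) :
    T.halfProduct R ε a =
      T.block ε ε (List.ofFn fun i => inverseTwistedComm hR (a i)).prod := by
  rw [halfProduct, ← prod_ofFn_block ε fun i => commute_grading_inverseTwistedComm hR (a i)]
  simp only [halfForm_eq hR]

variable {C s : ℝ} {n : ℕ}

theorem isTraceClass_halfProduct (hR : IsBoundedInverse T.D R) (hs0 : 0 < s)
    (hRs : DyadicApprox 1 C s R) (hsn : s ^ (n + 1) < 1 / 2) (ε : ℤˣ) (a : Fin (n + 1) → B) :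
    IsTraceClass (T.halfProduct R ε a) := by
  rw [halfProduct_eq hR]
  have h := (hRs.prod_ofFn hs0.le fun i => T.twistedComm (a i)).compress
    (T.half ε).orthogonalProjectionOnto (T.half ε).subtypeL
    (Submodule.orthogonalProjectionOnto_norm_le _) (Submodule.norm_subtypeL_le _)
  exact h.isTraceClass (by positivity) hsn

theorem halfCharacter_eq (hR : IsBoundedInverse T.D R) (hs0 : 0 < s)
    (hRs : DyadicApprox 1 C s R) (hsn : s ^ (n + 1) < 1 / 2) (ε : ℤˣ) (a : Fin (n + 1) → B) :
    T.halfCharacter R ε a =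
      opTrace (T.proj ε * (List.ofFn fun i => inverseTwistedComm hR (a i)).prod) := by
  have h := (hRs.prod_ofFn hs0.le fun i => T.twistedComm (a i)).nuclearBound (by positivity) hsn
  rw [halfCharacter, halfProduct_eq hR]
  exact ((h.comp_left (T.half ε).orthogonalProjectionOnto).opTrace_comm (T.half ε).subtypeL).symm

/-- The trace of the operators that commute with the grading, restricted to `H_ε`. -/
theorem opTrace_proj_mul_comm {s' : ℝ} {X Y : H →L[ℂ] H} {ε : ℤˣ} (hX : Commute T.γ X)
    (hXs : HasDyadicRate s X) (hYs : HasDyadicRate s' Y) (hs : 0 ≤ s) (hs1 : s < 1) (hs' : 0 < s')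
    (hss : s * s' < 1 / 2) : opTrace (T.proj ε * (X * Y)) = opTrace (T.proj ε * (Y * X)) := by
  rw [← mul_assoc, (commute_proj hX ε).eq, mul_assoc, ← mul_assoc (T.proj ε) Y]
  exact hXs.opTrace_comm (hYs.bounded_mul _) hs hs1 hs' hss

/-- Besides the cocycle property, `Θ` records that the cocycle is a norm-continuous form in the
operators `d_σ aⁱ`; differentiability along the flow is deduced from it. -/
theorem exists_cocycle_eq_halfCharacter [IsScalarTower ℂ B B] [SMulCommClass ℂ B B]
    (hR : IsBoundedInverse T.D R) (hs0 : 0 < s) (hs1 : s < 1)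
    (hRs : DyadicApprox 1 C s R) (hsn : s ^ (n + 1) < 1 / 2) (hn : Even n) (ε : ℤˣ) :
    ∃ φ ∈ cyclicCocycles B n, (∀ a, φ a = T.halfCharacter R ε a) ∧
      ∃ Θ : ContinuousMultilinearMap ℂ (fun _ : Fin (n + 1) => H →L[ℂ] H) ℂ,
        ∀ a, φ a = Θ fun i => T.twistedComm (a i) := by
  obtain ⟨t, ht⟩ := exists_linear_extension_opTrace H
  have hF : ∀ a, HasDyadicRate s (inverseTwistedComm hR a) := fun a =>
    HasDyadicRate.mul_bounded ⟨1, C, hRs⟩ _ hs0.le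
  have hprod : ∀ (k : ℕ) (a : Fin k → B),
      HasDyadicRate (s ^ k) (List.ofFn fun i => inverseTwistedComm hR (a i)).prod := fun k a =>
    ⟨_, _, hRs.prod_ofFn hs0.le fun i => T.twistedComm (a i)⟩
  have hγ := fun a => commute_grading_inverseTwistedComm hR a
  have hπ : ∀ a, Commute T.γ (T.π a) := T.γ_comm
  have htP : ∀ X : H →L[ℂ] H, HasDyadicRate (s ^ (n + 1)) X →
      (t ∘ₗ LinearMap.mulLeft ℂ (T.proj ε)) X = opTrace (T.proj ε * X) := fun X hX => by
    obtain ⟨c, hc⟩ := (hX.bounded_mul (T.proj ε)).exists_nuclearBound (by positivity) hsn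
    exact ht _ c hc
  have hss : s * s ^ n < 1 / 2 := by rwa [← pow_succ']
  refine ⟨traceForm (t ∘ₗ LinearMap.mulLeft ℂ (T.proj ε)) (inverseTwistedComm hR) n,
    traceForm_mem_cyclicCocycles (π := (T.π : B →ₗ[ℂ] H →L[ℂ] H)) (inverseTwistedComm_mul hR) hn
      (fun x a => ?_) (fun x a => ?_) (fun x y a => ?_), fun a => ?_, ?_⟩
  · rw [htP _ (by rw [pow_succ']; exact (hF x).mul (hprod n a) hs0.le),
      htP _ (by rw [pow_succ]; exact (hprod n a).mul (hF x) (by positivity))]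
    exact opTrace_proj_mul_comm (hγ x) (hF x) (hprod n a) hs0.le hs1 (by positivity) hss
  -- A bounded operator has only rate `1`, so the full product, of rate `sⁿ⁺¹ < 1`, takes the place
  -- of the factor commuting with `γ`.
  · have h1 : HasDyadicRate 1 (T.π x) := ⟨_, _, DyadicApprox.of_bounded _⟩
    refine (htP _ ((hprod _ a).bounded_mul (T.π x))).trans (Eq.trans ?_
      (htP _ ((hprod _ a).mul_bounded (T.π x) (by positivity))).symm)
    exact (opTrace_proj_mul_comm (Commute.prod_ofFn fun i => hγ (a i)) (hprod _ a) h1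
      (by positivity) (by linarith) one_pos (by linarith)).symm
  · set Y : H →L[ℂ] H := T.π y - inverseTwistedComm hR y
    have hY := (hprod n a).bounded_mul Y
    refine (htP _ (by rw [pow_succ']; exact (hF x).mul hY hs0.le)).trans (Eq.trans ?_
      (htP _ (by rw [pow_succ]; exact hY.mul (hF x) (by positivity))).symm)
    exact opTrace_proj_mul_comm (hγ x) (hF x) hY hs0.le hs1 (by positivity) hss
  · rw [halfCharacter_eq hR hs0 hRs hsn, traceForm_apply, htP _ (hprod _ a)]
  · let Θ : MultilinearMap ℂ (fun _ : Fin (n + 1) => H →L[ℂ] H) ℂ :=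
      traceForm (t ∘ₗ LinearMap.mulLeft ℂ (T.proj ε)) (LinearMap.mulLeft ℂ R) n
    have hΘ : ∀ S, ‖Θ S‖ ≤ ‖T.proj ε‖ * C ^ (n + 1) *
        (6 * (n + 1 : ℕ) * (1 - 2 * s ^ (n + 1))⁻¹) * ∏ i, ‖S i‖ := fun S => by
      have h := hRs.prod_ofFn hs0.le S
      have h2 := (h.nuclearBound (by positivity) hsn).comp_left (T.proj ε)
      have h3 : Θ S = opTrace (T.proj ε * (List.ofFn fun i => R * S i).prod) := by
        rw [← htP _ ⟨_, _, h⟩]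
        exact traceForm_apply _ _ _ _
      rw [h3]
      refine (h2.norm_opTrace_le).trans (le_of_eq ?_)
      rw [Finset.prod_mul_distrib, Finset.prod_const, Finset.card_univ, Fintype.card_fin]
      ring
    exact ⟨Θ.mkContinuous _ hΘ, fun a => rfl⟩

/-- The adjoint of the product of `n + 1` factors contributes the sign `(-1)ⁿ⁺¹ = -1` and puts `R`
to the right of each `d_σ`. Carrying the last `R` around the trace and past the projection replaces
`ε` by `-ε`. The two factors exchanged there, of rates `s` and `sⁿ`, need not be of trace class
separately. -/
theorem conj_halfCharacter (hR : IsBoundedInverse T.D R) (hs0 : 0 < s) (hs1 : s < 1)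
    (hRs : DyadicApprox 1 C s R) (hsn : s ^ (n + 1) < 1 / 2) (hn : Even n) (ε : ℤˣ)
    (a : Fin (n + 1) → B) :
    conj (T.halfCharacter R ε fun i => star (a (Fin.rev i))) =
      -T.halfCharacter R (-ε) fun i => σ.symm (a i) := by
  set f : Fin (n + 1) → H →L[ℂ] H := fun i => T.twistedComm (σ.symm (a i)) with hf
  have h1 : star (T.proj ε * (List.ofFn fun i => inverseTwistedComm hR (star (a (Fin.rev i)))).prod) =
      (-1 : ℂ) • ((List.ofFn fun i => f i * R).prod * T.proj ε) := by
    rw [star_mul, star_proj, star_prod_ofFn, ← smul_mul_assoc]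
    congr 1
    have h2 : ∀ i, star (inverseTwistedComm hR (star (a (Fin.rev (Fin.rev i))))) =
        (-1 : ℂ) • (f i * R) := fun i => by
      rw [inverseTwistedComm_apply, star_mul, star_inverse hR, Fin.rev_rev,
        star_twistedComm_star hR, neg_mul, neg_one_smul]
    simp only [h2]
    have := (MultilinearMap.mkPiAlgebraFin ℂ (n + 1) (H →L[ℂ] H)).map_smul_univ
      (fun _ => (-1 : ℂ)) fun i => f i * R
    simpa [MultilinearMap.mkPiAlgebraFin_apply, hn.add_one.neg_one_pow] using this
  have hγ : ∀ i, Commute T.γ (f i * R) := fun i => by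
    rw [commute_iff_eq, ← mul_assoc, grading_mul_twistedComm hR, neg_mul, mul_assoc,
      grading_mul_inverse hR]
    noncomm_ring
  have hP := (commute_proj (Commute.prod_ofFn hγ) ε).eq
  have hRd : HasDyadicRate s R := ⟨1, C, hRs⟩
  set Z : H →L[ℂ] H := (List.ofFn fun i : Fin n => R * f i.succ).prod with hZ
  have hZs : HasDyadicRate (s ^ n) (T.proj ε * (f 0 * Z)) :=
    (HasDyadicRate.bounded_mul _ ⟨_, _, hRs.prod_ofFn hs0.le fun i => f i.succ⟩).bounded_mul _
  have h3 : (List.ofFn fun i => f i * R).prod = f 0 * Z * R := by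
    rw [List.ofFn_succ, List.prod_cons, mul_assoc, mul_prod_ofFn_mul, mul_assoc]
  have h4 : (List.ofFn fun i => R * f i).prod = R * (f 0 * Z) := by
    rw [List.ofFn_succ, List.prod_cons, mul_assoc]
  rw [halfCharacter_eq hR hs0 hRs hsn, halfCharacter_eq hR hs0 hRs hsn, ← opTrace_adjoint,
    ← ContinuousLinearMap.star_eq_adjoint, h1, NuclearBound.opTrace_smul, neg_one_mul, ← hP, h3,
    neg_inj]
  have h5 : (List.ofFn fun i => inverseTwistedComm hR (σ.symm (a i))).prod = R * (f 0 * Z) := h4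
  rw [h5, ← mul_assoc, ← mul_assoc (T.proj (-ε)), proj_mul_of_anticommute (grading_mul_inverse hR),
    neg_neg, mul_assoc R, mul_assoc]
  refine Eq.trans ?_
    (hRd.opTrace_comm hZs hs0.le hs1 (by positivity) (by rwa [← pow_succ'])).symm
  simp only [mul_assoc]

end Character

end GradedTwistedTriple

/-! ### Automatic continuity and entire functions -/

/-- A `*`-representation of an involutive Banach algebra is contractive. -/
theorem NonUnitalStarAlgHom.norm_apply_le_of_banach {A : Type*} [NonUnitalNormedRing A] [StarRing A]
    [NormedSpace ℂ A] [IsScalarTower ℂ A A] [SMulCommClass ℂ A A] [NormedStarGroup A]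
    [CompleteSpace A] {E : Type*} [CStarAlgebra E] (ρ : A →⋆ₙₐ[ℂ] E) (a : A) : ‖ρ a‖ ≤ ‖a‖ := by
  have hsa : ∀ x : A, IsSelfAdjoint (ρ x) → ‖ρ x‖₊ ≤ ‖x‖₊ := fun x hx => by
    -- In the `ℓ¹`-unitization spectral radii can be compared: for self-adjoint `ρ x` the norm is
    -- the spectral radius, which a unital homomorphism does not increase and which is at most
    -- `‖x‖`. The general case follows with `x = a* a`.
    let e : WithLp 1 (Unitization ℂ A) ≃ₐ[ℂ] Unitization ℂ A := WithLp.unitizationAlgEquiv ℂ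
    let ψ : WithLp 1 (Unitization ℂ A) →ₐ[ℂ] E :=
      (Unitization.lift (ρ : A →ₙₐ[ℂ] E)).comp e.toAlgHom
    have hψ : ψ (WithLp.toLp 1 (x : Unitization ℂ A)) = ρ x := by
      change Unitization.lift (ρ : A →ₙₐ[ℂ] E) (x : Unitization ℂ A) = ρ x
      simp
      rfl
    have h1 : spectralRadius ℂ (ρ x) ≤ spectralRadius ℂ (WithLp.toLp 1 (x : Unitization ℂ A)) := by
      rw [← hψ]
      exact iSup_le_iSup_of_subset (AlgHom.spectrum_apply_subset ψ _)
    have h2 : spectralRadius ℂ (WithLp.toLp 1 (x : Unitization ℂ A)) ≤ ‖x‖₊ := by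
      have : NormOneClass (WithLp 1 (Unitization ℂ A)) := ⟨by
        rw [WithLp.unitization_norm_def]
        change ‖(1 : ℂ)‖ + ‖(0 : A)‖ = 1
        simp⟩
      refine (spectrum.spectralRadius_le_nnnorm _).trans ?_
      rw [WithLp.unitization_nnnorm_inr]
    rw [hx.spectralRadius_eq_nnnorm] at h1
    exact_mod_cast h1.trans h2
  have h1 : ‖ρ (star a * a)‖ ≤ ‖star a * a‖ :=
    hsa (star a * a) (by rw [map_mul, map_star]; exact IsSelfAdjoint.star_mul_self _)
  rw [map_mul, map_star, CStarRing.norm_star_mul_self] at h1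
  have h2 := norm_mul_le (star a) a
  rw [norm_star] at h2
  nlinarith [norm_nonneg (ρ a), norm_nonneg a]

/-- Entire functions that agree on the real line are equal. -/
theorem Differentiable.eq_of_eq_ofReal {E : Type*} [NormedAddCommGroup E] [NormedSpace ℂ E]
    [CompleteSpace E] {f g : ℂ → E} (hf : Differentiable ℂ f) (hg : Differentiable ℂ g)
    (h : ∀ t : ℝ, f t = g t) : f = g := by
  have hF : AnalyticOnNhd ℂ f Set.univ := hf.differentiableOn.analyticOnNhd isOpen_univ
  have hG : AnalyticOnNhd ℂ g Set.univ := hg.differentiableOn.analyticOnNhd isOpen_univ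
  refine hF.eq_of_frequently_eq hG (z₀ := ((0 : ℝ) : ℂ)) ?_
  have ht : Filter.Tendsto (fun t : ℝ => (t : ℂ)) (nhdsWithin 0 {0}ᶜ)
      (nhdsWithin ((0 : ℝ) : ℂ) {((0 : ℝ) : ℂ)}ᶜ) :=
    tendsto_nhdsWithin_of_tendsto_nhds_of_eventually_within _
      (Complex.continuous_ofReal.continuousAt.tendsto.mono_left nhdsWithin_le_nhds)
      (eventually_nhdsWithin_of_forall fun t ht => by simpa using ht)
  exact ht.frequently (Filter.Eventually.frequently (Filter.Eventually.of_forall h))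

/-- A second-order Taylor estimate, uniform on bounded sets. -/
theorem exists_taylor_bound_of_differentiable {E : Type*} [NormedAddCommGroup E] [NormedSpace ℂ E]
    [CompleteSpace E] {f : ℂ → E} (hf : Differentiable ℂ f) (r : ℝ) :
    ∃ C, ∀ z w : ℂ, ‖z‖ ≤ r → ‖w‖ ≤ 1 → ‖f (z + w) - f z - w • deriv f z‖ ≤ C * ‖w‖ ^ 2 := by
  have hf1 : Differentiable ℂ (deriv f) := fun z =>
    ((hf.differentiableOn.deriv isOpen_univ) z (Set.mem_univ z)).differentiableAt Filter.univ_mem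
  have hf2 : Differentiable ℂ (deriv (deriv f)) := fun z =>
    ((hf1.differentiableOn.deriv isOpen_univ) z (Set.mem_univ z)).differentiableAt Filter.univ_mem
  obtain ⟨C, hC⟩ := (isCompact_closedBall (0 : ℂ) (r + 1)).exists_bound_of_continuousOn
    hf2.continuous.continuousOn
  refine ⟨C, fun z w hz hw => ?_⟩
  have hseg : ∀ u : ℂ, ‖u‖ ≤ ‖w‖ → z + u ∈ Metric.closedBall (0 : ℂ) (r + 1) := fun u hu => by
    rw [mem_closedBall_zero_iff]
    exact (norm_add_le _ _).trans (by linarith)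
  have h1 : ∀ u : ℂ, ‖u‖ ≤ ‖w‖ → ‖deriv f (z + u) - deriv f z‖ ≤ C * ‖w‖ := fun u hu => by
    have h := Convex.norm_image_sub_le_of_norm_deriv_le (𝕜 := ℂ) (f := deriv f)
      (fun x _ => hf1 x) hC (convex_closedBall (0 : ℂ) (r + 1)) (by simpa using hseg 0 (by simp))
      (hseg u hu)
    rw [add_sub_cancel_left] at h
    have hC0 : 0 ≤ C := (norm_nonneg _).trans (hC _ (hseg u hu))
    exact h.trans (mul_le_mul_of_nonneg_left hu hC0)
  have hg : ∀ u : ℂ, HasDerivAt (fun u => f (z + u) - u • deriv f z)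
      (deriv f (z + u) - deriv f z) u := fun u => by
    have h2 : HasDerivAt (fun u => f (z + u)) (deriv f (z + u)) u := by
      simpa using (hf (z + u)).hasDerivAt.comp_const_add z u
    simpa using! h2.sub ((hasDerivAt_id u).smul_const (deriv f z))
  have h3 := Convex.norm_image_sub_le_of_norm_hasDerivWithin_le
    (fun u _ => (hg u).hasDerivWithinAt) (fun u hu => h1 u (mem_closedBall_zero_iff.1 hu))
    (convex_closedBall (0 : ℂ) ‖w‖) (x := 0) (y := w) (by simp) (by simp)
  have h4 : f (z + w) - w • deriv f z - (f (z + 0) - (0 : ℂ) • deriv f z) =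
      f (z + w) - f z - w • deriv f z := by
    rw [add_zero, zero_smul, sub_zero]
    abel
  rw [h4, sub_zero] at h3
  rw [pow_two, ← mul_assoc]
  exact h3

/-! ### The complex flow on the analytic elements and its generator -/

namespace OneParamGroup

variable {A : Type*} [NonUnitalNormedRing A] [StarRing A] [NormedSpace ℂ A]

section Auto

variable (U : OneParamGroup A)

/-- The automorphism `σ_t` as a continuous linear map. -/
def autL (t : ℝ) : A →L[ℂ] A :=
  LinearMap.mkContinuous (U.aut t : A →ₗ[ℂ] A) 1 fun a => by simpa using (U.norm_aut t a).le

theorem autL_apply (t : ℝ) (a : A) : U.autL t a = U.aut t a := rfl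

end Auto

variable {U : OneParamGroup A}

theorem IsAnalyticExtension.apply_zero {a : A} {f : ℂ → A} (hf : U.IsAnalyticExtension a f) :
    f 0 = a := by
  have := hf.2 0
  rwa [U.aut_zero, Complex.ofReal_zero] at this

section Ext

variable [IsScalarTower ℂ A A] [SMulCommClass ℂ A A] [NormedStarGroup A] [StarModule ℂ A]

/-- The analytic extension of the orbit of `a`. -/
def ext (a : U.analyticElements) : ℂ → A := a.2.choose

theorem isAnalyticExtension_ext (a : U.analyticElements) :
    U.IsAnalyticExtension (a : A) (ext a) := a.2.choose_spec

theorem ext_zero (a : U.analyticElements) : ext a 0 = a := (isAnalyticExtension_ext a).apply_zero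

end Ext

variable [CompleteSpace A]

theorem IsAnalyticExtension.unique {a : A} {f g : ℂ → A} (hf : U.IsAnalyticExtension a f)
    (hg : U.IsAnalyticExtension a g) : f = g :=
  hf.1.eq_of_eq_ofReal hg.1 fun t => (hf.2 t).trans (hg.2 t).symm

/-- Both sides are entire in `w` and agree for real `w` by the group law. Consequently `σ_w(a)` is
again an analytic element, with the translated extension. -/
theorem IsAnalyticExtension.apply_ofReal_add {a : A} {f : ℂ → A} (hf : U.IsAnalyticExtension a f)
    (t : ℝ) (w : ℂ) : f (t + w) = U.aut t (f w) := by
  have h := Differentiable.eq_of_eq_ofReal (f := fun w => f (t + w)) (g := fun w => U.autL t (f w))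
    (hf.1.comp ((differentiable_const _).add differentiable_id))
    ((U.autL t).differentiable.comp hf.1) fun s => by
      rw [autL_apply, hf.2, ← U.aut_add, ← hf.2, Complex.ofReal_add]
  exact congrFun h w

theorem IsAnalyticExtension.translate {a : A} {f : ℂ → A} (hf : U.IsAnalyticExtension a f)
    (w : ℂ) : U.IsAnalyticExtension (f w) fun z => f (z + w) :=
  ⟨hf.1.comp (differentiable_id.add (differentiable_const _)), fun t => hf.apply_ofReal_add t w⟩

theorem IsAnalyticExtension.deriv {a : A} {f : ℂ → A} (hf : U.IsAnalyticExtension a f) :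
    U.IsAnalyticExtension (deriv f 0) (deriv f) := by
  refine ⟨fun z => ((hf.1.differentiableOn.deriv isOpen_univ) z
    (Set.mem_univ z)).differentiableAt Filter.univ_mem, fun t => ?_⟩
  have h1 : HasDerivAt (fun w => f (t + w)) (_root_.deriv f t) 0 := by
    have := (hf.1 (t + 0)).hasDerivAt.comp_const_add (t : ℂ) 0
    simpa using this
  have h2 : HasDerivAt (fun w => U.autL t (f w)) (U.autL t (_root_.deriv f 0)) 0 :=
    (U.autL t).hasFDerivAt.comp_hasDerivAt 0 (hf.1 0).hasDerivAt
  have h3 : (fun w => f (t + w)) = fun w => U.autL t (f w) :=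
    funext fun w => hf.apply_ofReal_add t w
  rw [h3] at h1
  exact h1.unique h2

variable [IsScalarTower ℂ A A] [SMulCommClass ℂ A A] [NormedStarGroup A] [StarModule ℂ A]

theorem IsAnalyticExtension.eq_ext {a : U.analyticElements} {f : ℂ → A}
    (hf : U.IsAnalyticExtension (a : A) f) : f = ext a :=
  hf.unique (isAnalyticExtension_ext a)

theorem ext_add (a b : U.analyticElements) : ext (a + b) = fun z => ext a z + ext b z := by
  have ha := isAnalyticExtension_ext a
  have hb := isAnalyticExtension_ext b
  exact (IsAnalyticExtension.eq_ext ⟨ha.1.add hb.1, fun t => by simp [ha.2, hb.2]⟩).symm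

theorem ext_smul (c : ℂ) (a : U.analyticElements) : ext (c • a) = fun z => c • ext a z := by
  have ha := isAnalyticExtension_ext a
  exact (IsAnalyticExtension.eq_ext ⟨ha.1.const_smul c, fun t => by simp [ha.2]⟩).symm

theorem ext_mul (a b : U.analyticElements) : ext (a * b) = fun z => ext a z * ext b z := by
  have ha := isAnalyticExtension_ext a
  have hb := isAnalyticExtension_ext b
  exact (IsAnalyticExtension.eq_ext
    ⟨((ContinuousLinearMap.mul ℂ A).isBoundedBilinearMap.differentiable).comp (ha.1.prodMk hb.1),
      fun t => by simp [ha.2, hb.2]⟩).symm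

/-- The automorphism `σ_w` of the algebra of analytic elements. -/
def flow (w : ℂ) : U.analyticElements →ₗ[ℂ] U.analyticElements where
  toFun a := ⟨ext a w, _, (isAnalyticExtension_ext a).translate w⟩
  map_add' a b := Subtype.ext (by simp [ext_add])
  map_smul' c a := Subtype.ext (by simp [ext_smul])

theorem coe_flow (w : ℂ) (a : U.analyticElements) : (flow w a : A) = ext a w := rfl

theorem flow_mul (w : ℂ) (a b : U.analyticElements) : flow w (a * b) = flow w a * flow w b :=
  Subtype.ext (by simp [coe_flow, ext_mul])

theorem flow_zero (a : U.analyticElements) : flow 0 a = a := Subtype.ext (ext_zero a)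

theorem ext_flow (w : ℂ) (a : U.analyticElements) : ext (flow w a) = fun z => ext a (z + w) :=
  (IsAnalyticExtension.eq_ext ((isAnalyticExtension_ext a).translate w)).symm

theorem flow_flow (z w : ℂ) (a : U.analyticElements) : flow z (flow w a) = flow (z + w) a :=
  Subtype.ext (by rw [coe_flow, ext_flow, coe_flow])

/-- The generator of the flow. -/
def generator : U.analyticElements →ₗ[ℂ] U.analyticElements where
  toFun a := ⟨deriv (ext a) 0, _, (isAnalyticExtension_ext a).deriv⟩
  map_add' a b := Subtype.ext (by
    have ha := isAnalyticExtension_ext a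
    have hb := isAnalyticExtension_ext b
    simp only [ext_add]
    exact deriv_fun_add (ha.1 0) (hb.1 0))
  map_smul' c a := Subtype.ext (by
    have ha := isAnalyticExtension_ext a
    simp only [ext_smul]
    exact deriv_fun_const_smul c (ha.1 0))

theorem coe_generator (a : U.analyticElements) : (generator a : A) = deriv (ext a) 0 := rfl

theorem ext_generator (a : U.analyticElements) : ext (generator a) = deriv (ext a) :=
  (IsAnalyticExtension.eq_ext (isAnalyticExtension_ext a).deriv).symm

theorem generator_mul (a b : U.analyticElements) :
    generator (a * b) = generator a * b + a * generator b := by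
  have ha := ((isAnalyticExtension_ext a).1 0).hasDerivAt
  have hb := ((isAnalyticExtension_ext b).1 0).hasDerivAt
  refine Subtype.ext ?_
  have h := ((ContinuousLinearMap.mul ℂ A).isBoundedBilinearMap.hasFDerivAt
    (ext a 0, ext b 0)).comp_hasDerivAt 0 (ha.prodMk hb)
  have h2 : HasDerivAt (ext (a * b)) (ext a 0 * deriv (ext b) 0 + deriv (ext a) 0 * ext b 0) 0 := by
    rw [ext_mul]
    simpa [Function.comp_def] using h
  rw [coe_generator, h2.deriv, ext_zero, ext_zero, add_comm]
  rfl

theorem generator_flow (w : ℂ) (a : U.analyticElements) :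
    generator (flow w a) = flow w (generator a) := by
  refine Subtype.ext ?_
  rw [coe_generator, ext_flow, coe_flow, ext_generator]
  simpa using deriv_comp_add_const (ext a) w 0

section OnePG

variable {σ : U.analyticElements ≃ₗ[ℂ] U.analyticElements}

theorem OnePG.coe_apply (hσ : U.OnePG σ) (a : U.analyticElements) :
    (σ a : A) = ext a (-Complex.I) := by
  obtain ⟨f, hf, hf'⟩ := hσ a
  rw [← hf', hf.eq_ext]

theorem OnePG.symm_apply (hσ : U.OnePG σ) (a : U.analyticElements) :
    σ.symm a = flow Complex.I a := by
  rw [LinearEquiv.symm_apply_eq]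
  refine Subtype.ext ?_
  rw [hσ.coe_apply, ext_flow]
  simp only [neg_add_cancel, ext_zero]

end OnePG

end OneParamGroup

/-! ### Differentiability of closed maps along the flow -/

namespace OneParamGroup

variable {A : Type*} [NonUnitalNormedRing A] [StarRing A] [NormedSpace ℂ A] [IsScalarTower ℂ A A]
  [SMulCommClass ℂ A A] [StarModule ℂ A] [NormedStarGroup A] [CompleteSpace A]
  {U : OneParamGroup A}

section Superposition

variable {ι : Type*} {b : ι → U.analyticElements}

theorem summable_norm_lp_one (h : lp (fun _ : ι => ℂ) 1) : Summable fun i => ‖h i‖ := by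
  have := (lp.memℓp h).summable (by norm_num)
  simpa using this

theorem tsum_norm_lp_one (h : lp (fun _ : ι => ℂ) 1) : ∑' i, ‖h i‖ = ‖h‖ := by
  have := lp.norm_eq_tsum_rpow (p := 1) (by norm_num) h
  simpa using this.symm

variable (hb : ∀ r : ℝ, ∃ C, ∀ (i : ι) (z : ℂ), ‖z‖ ≤ r → ‖ext (b i) z‖ ≤ C)

include hb

omit [CompleteSpace A] in
theorem summable_norm_smul_ext (h : lp (fun _ : ι => ℂ) 1) (z : ℂ) :
    Summable fun i => ‖h i • ext (b i) z‖ := by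
  obtain ⟨C, hC⟩ := hb ‖z‖
  refine Summable.of_nonneg_of_le (fun _ => norm_nonneg _) (fun i => ?_)
    ((summable_norm_lp_one h).mul_right C)
  rw [norm_smul]
  exact mul_le_mul_of_nonneg_left (hC i z le_rfl) (norm_nonneg _)

/-- The continuous linear map `h ↦ ∑ᵢ hᵢ σ_z(bᵢ)` on `ℓ¹`. -/
theorem exists_superposition (z : ℂ) :
    ∃ S : lp (fun _ : ι => ℂ) 1 →L[ℂ] A, ∀ h, S h = ∑' i, h i • ext (b i) z := by
  obtain ⟨C, hC⟩ := hb ‖z‖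
  refine ⟨LinearMap.mkContinuous
    { toFun := fun h => ∑' i, h i • ext (b i) z
      map_add' := fun g h => ?_
      map_smul' := fun c h => ?_ } C fun h => ?_, fun h => rfl⟩
  · rw [← (summable_norm_smul_ext hb g z).of_norm.tsum_add (summable_norm_smul_ext hb h z).of_norm]
    simp [add_smul]
  · simp only [lp.coeFn_smul, Pi.smul_apply, smul_assoc, RingHom.id_apply]
    exact (summable_norm_smul_ext hb h z).of_norm.tsum_const_smul c
  · refine (norm_tsum_le_tsum_norm (summable_norm_smul_ext hb h z)).trans ?_
    rw [mul_comm, ← tsum_norm_lp_one, ← tsum_mul_right]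
    refine (summable_norm_smul_ext hb h z).tsum_le_tsum (fun i => ?_)
      ((summable_norm_lp_one h).mul_right C)
    rw [norm_smul]
    exact mul_le_mul_of_nonneg_left (hC i z le_rfl) (norm_nonneg _)

theorem isAnalyticExtension_tsum (h : lp (fun _ : ι => ℂ) 1) :
    U.IsAnalyticExtension (∑' i, h i • ext (b i) 0) fun z => ∑' i, h i • ext (b i) z := by
  refine ⟨fun z => ?_, fun t => ?_⟩
  · obtain ⟨C, hC⟩ := hb (‖z‖ + 1)
    have := Complex.differentiableOn_tsum_of_summable_norm (U := Metric.ball (0 : ℂ) (‖z‖ + 1))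
      (F := fun i z => h i • ext (b i) z) ((summable_norm_lp_one h).mul_right C)
      (fun i => ((isAnalyticExtension_ext (b i)).1.const_smul (h i)).differentiableOn)
      Metric.isOpen_ball (fun i w hw => by
        rw [norm_smul]
        exact mul_le_mul_of_nonneg_left (hC i w (mem_ball_zero_iff.1 hw).le) (norm_nonneg _))
    exact this.differentiableAt (Metric.isOpen_ball.mem_nhds (by simp))
  · rw [← autL_apply, (U.autL t).map_tsum (summable_norm_smul_ext hb h 0).of_norm]
    refine tsum_congr fun i => ?_
    rw [map_smul, ext_zero, autL_apply, (isAnalyticExtension_ext (b i)).2]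

/-- A linear map on the algebra of analytic elements that is closed with respect to the values of
the analytic extensions at `0` and at `w` is bounded on sets of elements whose analytic extensions
are locally uniformly bounded. -/
theorem exists_norm_le_of_closed {E : Type*} [NormedAddCommGroup E] [NormedSpace ℂ E]
    [CompleteSpace E] (w : ℂ) (d : U.analyticElements →ₗ[ℂ] E)
    (hd : ∀ (u : ℕ → U.analyticElements) (a : U.analyticElements) (y : E),
      Filter.Tendsto (fun k => ext (u k) 0) Filter.atTop (nhds (ext a 0)) →
      Filter.Tendsto (fun k => ext (u k) w) Filter.atTop (nhds (ext a w)) →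
      Filter.Tendsto (fun k => d (u k)) Filter.atTop (nhds y) → y = d a) :
    ∃ C, ∀ i, ‖d (b i)‖ ≤ C := by
  classical
  choose S hS using exists_superposition hb
  have hext : ∀ h, U.IsAnalyticExtension (S 0 h) fun z => S z h := fun h => by
    simp only [hS]
    exact isAnalyticExtension_tsum hb h
  -- The analytic elements need not be complete in the norm of `A`, so the closed graph theorem is
  -- applied to `d ∘ L` on the Banach space `ℓ¹`. The map `L` sends the unit vector at `i` to `b i`,
  -- and the norm of `d ∘ L` bounds all `d (b i)` at once.
  let L : lp (fun _ : ι => ℂ) 1 →ₗ[ℂ] U.analyticElements :=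
    { toFun := fun h => ⟨S 0 h, _, hext h⟩
      map_add' := fun g h => Subtype.ext (map_add (S 0) g h)
      map_smul' := fun c h => Subtype.ext (map_smul (S 0) c h) }
  have hL : ∀ h z, ext (L h) z = S z h := fun h z =>
    (congrFun (IsAnalyticExtension.eq_ext (a := L h) (hext h)) z).symm
  have hcont : Continuous (d ∘ₗ L) := by
    refine (d ∘ₗ L).continuous_of_seq_closed_graph fun u x y hu hy => ?_
    refine hd (fun k => L (u k)) (L x) y ?_ ?_ hy
    · simp only [hL]
      exact ((S 0).continuous.tendsto x).comp hu
    · simp only [hL]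
      exact ((S w).continuous.tendsto x).comp hu
  let G : lp (fun _ : ι => ℂ) 1 →L[ℂ] E := ⟨d ∘ₗ L, hcont⟩
  refine ⟨‖G‖, fun i => ?_⟩
  have h1 : L (lp.single 1 i 1) = b i := by
    refine Subtype.ext ?_
    change S 0 (lp.single 1 i 1) = b i
    rw [hS, tsum_eq_single i fun j hj => by simp [hj], ext_zero]
    simp
  have h2 := G.le_opNorm (lp.single 1 i 1)
  rw [lp.norm_single one_pos, norm_one, mul_one] at h2
  rw [← h1]
  exact h2

end Superposition

/-- A linear map that is closed in the above sense is differentiable along the flow. -/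
theorem hasDerivAt_flow_of_closed {E : Type*} [NormedAddCommGroup E] [NormedSpace ℂ E]
    [CompleteSpace E] (w₀ : ℂ) (d : U.analyticElements →ₗ[ℂ] E)
    (hd : ∀ (u : ℕ → U.analyticElements) (a : U.analyticElements) (y : E),
      Filter.Tendsto (fun k => ext (u k) 0) Filter.atTop (nhds (ext a 0)) →
      Filter.Tendsto (fun k => ext (u k) w₀) Filter.atTop (nhds (ext a w₀)) →
      Filter.Tendsto (fun k => d (u k)) Filter.atTop (nhds y) → y = d a)
    (a : U.analyticElements) (z : ℂ) :
    HasDerivAt (fun w => d (flow w a)) (d (flow z (generator a))) z := by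
  have key : ∀ a : U.analyticElements, HasDerivAt (fun w => d (flow w a)) (d (generator a)) 0 := by
    intro a
    -- The Taylor remainders `w⁻² (σ_w(a) - a - w δ(a))`, with `δ` the generator. Their extensions
    -- are bounded on bounded sets, uniformly in `w`, so the bound on `d (b w)` is a second-order
    -- Taylor estimate for `w ↦ d (σ_w(a))` at `0`.
    let b : {w : ℂ // w ≠ 0 ∧ ‖w‖ ≤ 1} → U.analyticElements := fun w =>
      ((w : ℂ) ^ 2)⁻¹ • (flow (w : ℂ) a + (-1 : ℂ) • a + (-(w : ℂ)) • generator a)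
    have hbext : ∀ w z, ext (b w) z = ((w : ℂ) ^ 2)⁻¹ •
        (ext a (z + w) - ext a z - (w : ℂ) • deriv (ext a) z) := fun w z => by
      simp only [b, ext_smul, ext_add, ext_flow, ext_generator]
      rw [neg_one_smul, neg_smul, ← sub_eq_add_neg, ← sub_eq_add_neg]
    obtain ⟨C, hC⟩ := exists_norm_le_of_closed (b := b) (fun r => by
      obtain ⟨C, hC⟩ := exists_taylor_bound_of_differentiable (isAnalyticExtension_ext a).1 r
      refine ⟨C, fun w z hz => ?_⟩
      rw [hbext, norm_smul, norm_inv, norm_pow, inv_mul_le_iff₀ (by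
        exact pow_pos (norm_pos_iff.2 w.2.1) 2), mul_comm]
      exact hC z w hz w.2.2) w₀ d hd
    rw [hasDerivAt_iff_isLittleO]
    have hO : (fun w : ℂ => d (flow w a) - d (flow 0 a) - (w - 0) • d (generator a)) =O[nhds 0]
        fun w : ℂ => ‖w - 0‖ ^ 2 := by
      refine Asymptotics.IsBigO.of_bound C ?_
      filter_upwards [Metric.closedBall_mem_nhds (0 : ℂ) one_pos] with w hw
      rw [mem_closedBall_zero_iff] at hw
      rcases eq_or_ne w 0 with rfl | hw0
      · simp
      · have h := hC ⟨w, hw0, hw⟩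
        simp only [b, map_smul, map_add] at h
        rw [norm_smul, norm_inv, inv_mul_le_iff₀ (norm_pos_iff.2 (pow_ne_zero 2 hw0)), mul_comm] at h
        rw [sub_zero, flow_zero, norm_pow, norm_norm, ← norm_pow]
        rwa [neg_one_smul, neg_smul, ← sub_eq_add_neg, ← sub_eq_add_neg] at h
    exact hO.trans_isLittleO (Asymptotics.isLittleO_pow_sub_sub (0 : ℂ) one_lt_two)
  -- By the group law, the derivative at `z` is the derivative at `0` for the element `σ_z(a)`.
  have h := key (flow z a)
  rw [generator_flow] at h
  have h2 : HasDerivAt (fun w => d (flow (w - z) (flow z a))) (d (flow z (generator a))) z := by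
    have h' : HasDerivAt (fun w => d (flow w (flow z a))) (d (flow z (generator a))) (z - z) := by
      rwa [sub_self]
    exact h'.comp_sub_const z z
  simpa [flow_flow] using h2

end OneParamGroup

/-! ### Closedness of `d_σ` and the main theorem -/

open OneParamGroup GradedTwistedTriple in
/-- The twisted commutator `a ↦ d_σ a` is closed with respect to the norms of `a` and `σ(a)`. -/
theorem twistedComm_closed
    {A : Type*} [NonUnitalNormedRing A] [StarRing A] [NormedSpace ℂ A] [IsScalarTower ℂ A A]
    [SMulCommClass ℂ A A] [StarModule ℂ A] [NormedStarGroup A] [CompleteSpace A]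
    {H : Type*} [NormedAddCommGroup H] [InnerProductSpace ℂ H] [CompleteSpace H]
    {U : OneParamGroup A}
    {σ : U.analyticElements ≃ₗ[ℂ] U.analyticElements} (hσ : U.OnePG σ)
    (ρ : A →⋆ₙₐ[ℂ] (H →L[ℂ] H))
    {T : GradedTwistedTriple σ H} (hρ : ∀ a : U.analyticElements, T.π a = ρ (a : A))
    {R : H →L[ℂ] H} (hR : IsBoundedInverse T.D R)
    (u : ℕ → U.analyticElements) (a : U.analyticElements) (y : H →L[ℂ] H)
    (h0 : Filter.Tendsto (fun k => ext (u k) 0) Filter.atTop (nhds (ext a 0)))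
    (h1 : Filter.Tendsto (fun k => ext (u k) (-Complex.I)) Filter.atTop
      (nhds (ext a (-Complex.I))))
    (hy : Filter.Tendsto (fun k => twistedCommₗ hR (u k)) Filter.atTop (nhds y)) :
    y = twistedCommₗ hR a := by
  -- The action of all of `A` enters here: being contractive it is continuous, so the right side of
  -- `R d_σ(x) R = x R - R σ(x)` passes to the limit.
  let ρL : A →L[ℂ] (H →L[ℂ] H) := LinearMap.mkContinuous (ρ : A →ₗ[ℂ] (H →L[ℂ] H)) 1 fun a => by
    simpa using ρ.norm_apply_le_of_banach a
  have hρL : ∀ x, T.π x = ρL (x : A) := hρ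
  refine eq_twistedComm hR ?_
  have e1 : Filter.Tendsto (fun k => R * twistedCommₗ hR (u k) * R) Filter.atTop
      (nhds (R * y * R)) := (hy.const_mul R).mul_const R
  refine tendsto_nhds_unique e1 ?_
  have e2 : ∀ x : U.analyticElements, R * twistedCommₗ hR x * R =
      ρL (ext x 0) * R - R * ρL (ext x (-Complex.I)) := fun x => by
    rw [ext_zero, ← hσ.coe_apply, ← hρL, ← hρL]
    exact inverse_mul_twistedComm hR x
  have e3 : T.π a * R - R * T.π (σ a) = ρL (ext a 0) * R - R * ρL (ext a (-Complex.I)) := by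
    rw [ext_zero, ← hσ.coe_apply, ← hρL, ← hρL]
  simp only [e2, e3]
  exact (((ρL.continuous.tendsto _).comp h0).mul_const R).sub
    (((ρL.continuous.tendsto _).comp h1).const_mul R)

end

open OneParamGroup GradedTwistedTriple in
theorem mainTheorem3
    {A : Type*} [NonUnitalNormedRing A] [StarRing A] [NormedSpace ℂ A] [IsScalarTower ℂ A A]
    [SMulCommClass ℂ A A] [StarModule ℂ A] [NormedStarGroup A] [CompleteSpace A]
    {H : Type*} [NormedAddCommGroup H] [InnerProductSpace ℂ H] [CompleteSpace H]
    (U : OneParamGroup A)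
    (σ : U.analyticElements ≃ₗ[ℂ] U.analyticElements) (hσ : U.OnePG σ)
    (ρ : A →⋆ₙₐ[ℂ] (H →L[ℂ] H))
    (T : GradedTwistedTriple σ H) (hρ : ∀ a : U.analyticElements, T.π a = ρ (a : A))
    (Dinv : H →L[ℂ] H) (hDinv : IsBoundedInverse T.D Dinv)
    (n : ℕ) (hn : Even n) (hn0 : n ≠ 0) (hsum : IsWeakSchatten (n : ℝ) Dinv) :
    (∀ (ε : ℤˣ) (a : Fin (n + 1) → U.analyticElements),
      IsTraceClass (T.halfProduct Dinv ε a)) ∧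
    ∃ Φplus Φminus Φplus_star : cyclicCocycles U.analyticElements n,
      (∀ a, Φplus.1 a = T.halfCharacter Dinv 1 a) ∧
      (∀ a, Φminus.1 a = T.halfCharacter Dinv (-1) a) ∧
      (∀ a, Φplus_star.1 a = conj (Φplus.1 fun i => star (a (Fin.rev i)))) ∧
      cyclicClass U.analyticElements n hn Φminus
        = -cyclicClass U.analyticElements n hn Φplus_star := by
  obtain ⟨C, hC⟩ := hsum.dyadicApprox
  set s : ℝ := (2 : ℝ) ^ (-1 / (n : ℝ)) with hs
  have hn1 : (0 : ℝ) < n := by positivity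
  have hs0 : 0 < s := by positivity
  have hs1 : s < 1 :=
    Real.rpow_lt_one_of_one_lt_of_neg one_lt_two (div_neg_of_neg_of_pos (by norm_num) hn1)
  -- `n` factors reach the critical rate `1/2` exactly; the extra factor of the character passes
  -- below it.
  have hsn : s ^ (n + 1) < 1 / 2 := by
    have h : s ^ n = 1 / 2 := by
      rw [hs, ← Real.rpow_natCast, ← Real.rpow_mul (by norm_num), div_mul_cancel₀ _ hn1.ne',
        Real.rpow_neg_one]
      norm_num
    rw [pow_succ, h]
    linarith
  refine ⟨isTraceClass_halfProduct hDinv hs0 hC hsn, ?_⟩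
  obtain ⟨φ, hφ, hφa, -⟩ := exists_cocycle_eq_halfCharacter hDinv hs0 hs1 hC hsn hn 1
  obtain ⟨ψ, hψ, hψa, Θ, hΘ⟩ := exists_cocycle_eq_halfCharacter hDinv hs0 hs1 hC hsn hn (-1)
  have hχ : ψ.compLinearMap (fun _ => (flow Complex.I : U.analyticElements →ₗ[ℂ] _)) ∈
      cyclicCocycles U.analyticElements n := compLinearMap_mem_cyclicCocycles hψ (flow_mul _)
  -- The cochain `(Φ⁺)*` is taken to be `-Φ⁻ ∘ σ_i`, which is visibly a cyclic cocycle; its defining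
  -- formula is then `conj_halfCharacter`.
  refine ⟨⟨φ, hφ⟩, ⟨ψ, hψ⟩, -⟨_, hχ⟩, hφa, hψa, fun a => ?_, ?_⟩
  · change -ψ (fun i => flow Complex.I (a i)) = conj (φ fun i => star (a (Fin.rev i)))
    rw [hφa, hψa, conj_halfCharacter hDinv hs0 hs1 hC hsn hn]
    simp only [hσ.symm_apply]
  · have hd : ∀ (a : U.analyticElements) (t : ℝ),
        HasDerivAt (fun t : ℝ => T.twistedComm (flow ((t : ℂ) * Complex.I) a))
          (T.twistedComm (flow ((t : ℂ) * Complex.I) (Complex.I • generator a))) t := fun a t => by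
      have h1 := hasDerivAt_flow_of_closed (-Complex.I) (twistedCommₗ hDinv)
        (twistedComm_closed hσ ρ hρ hDinv) a ((t : ℂ) * Complex.I)
      have h2 : HasDerivAt (fun t : ℝ => (t : ℂ) * Complex.I) Complex.I t := by
        simpa using (Complex.ofRealCLM.hasDerivAt (x := t)).mul_const Complex.I
      have h3 := h1.scomp t h2
      rw [← map_smul, ← map_smul] at h3
      exact h3
    -- The path `t ↦ σ_{ti}` runs from the identity to `σ_i = σ⁻¹`; its generator is `i` times that
    -- of the complex flow.
    have hrange := of_compLinearMap_sub_mem_range hn hψ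
      (fun t : ℝ => (flow ((t : ℂ) * Complex.I) : U.analyticElements →ₗ[ℂ] _))
      (fun t => flow_mul _) (Complex.I • generator)
      (fun a b => by simp [generator_mul, smul_mul_assoc, mul_smul_comm]) (fun v t => by
        simp only [hΘ]
        have h1 : HasDerivAt (fun (t : ℝ) i => T.twistedComm (flow ((t : ℂ) * Complex.I) (v i)))
            (fun i => T.twistedComm (flow ((t : ℂ) * Complex.I) (Complex.I • generator (v i)))) t :=
          hasDerivAt_pi.2 fun i => hd (v i) t
        have h2 := ((Θ.hasFDerivAt _).restrictScalars ℝ).comp_hasDerivAt t h1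
        refine h2.congr_deriv ?_
        change Θ.linearDeriv _ _ = _
        rw [ContinuousMultilinearMap.linearDeriv_apply]
        refine Finset.sum_congr rfl fun i _ => congrArg Θ (funext fun j => ?_)
        by_cases hj : j = i
        · subst hj; simp
        · simp [hj])
    have h0 : ψ.compLinearMap (fun _ => (flow (((0 : ℝ) : ℂ) * Complex.I) :
        U.analyticElements →ₗ[ℂ] _)) = ψ := by
      ext v
      simp [flow_zero]
    rw [h0, Complex.ofReal_one, one_mul] at hrange
    rw [← add_eq_zero_iff_eq_neg]
    refine (Submodule.Quotient.mk_eq_zero _).2 ?_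
    rw [Submodule.mem_comap]
    have := neg_mem hrange
    rw [← map_neg, neg_sub, sub_eq_add_neg ψ, map_add] at this
    exact this
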